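/- For $X\subseteq\omega$ let $X'=\{n : \Phi_n^X(n)\downarrow\}$ be the Turing jump of $X$, where $(\Phi_n)_{n\in\omega}$ is a standard effective enumeration of the Turing functionals; let $\mathbf 0'=\emptyset'$, let $X\oplus Y=\{2n : n\in X\}\cup\{2n+1 : n\in Y\}$, and let $\equiv_T$ denote Turing equivalence of sets. Then for every colouring $c:\omega\to\{1,2\}$ (an arbitrary instance of $\mathsf{RT}^1_2$, with no effectiveness assumption on $c$) there is an infinite set $G\subseteq\omega$ on which $c$ is constant (a nontrivial solution) such that $G$ is generalized low: $$G'\equiv_T G\oplus\mathbf 0'.$$ -/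

import Mathlib

/-- Programs for partial recursive functionals with one oracle. The constructors are those of
`Nat.RecursiveIn`, the instruction `oracle` being a query to the oracle. -/
inductive OracleCode : Type
  | zero : OracleCode
  | succ : OracleCode
  | left : OracleCode
  | right : OracleCode
  | oracle : OracleCode
  | pair : OracleCode → OracleCode → OracleCode
  | comp : OracleCode → OracleCode → OracleCode
  | prec : OracleCode → OracleCode → OracleCode
  | rfind : OracleCode → OracleCode

namespace OracleCode

/-- The partial function computed by a program with oracle `g`. -/
def eval (g : ℕ →. ℕ) : OracleCode → (ℕ →. ℕ)
  | zero => fun _ => Part.some 0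
  | succ => fun n => Part.some (n + 1)
  | left => fun n => Part.some (Nat.unpair n).1
  | right => fun n => Part.some (Nat.unpair n).2
  | oracle => g
  | pair c d => fun n => Nat.pair <$> eval g c n <*> eval g d n
  | comp c d => fun n => eval g d n >>= eval g c
  | prec c d => fun p =>
      let (a, n) := Nat.unpair p
      n.rec (eval g c a) fun y IH => do
        let i ← IH
        eval g d (Nat.pair a (Nat.pair y i))
  | rfind c => fun a => Nat.rfind fun n => (fun m => m = 0) <$> eval g c (Nat.pair a n)

/-- The Gödel number of a program. -/
def encode : OracleCode → ℕ
  | zero => 0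
  | succ => 1
  | left => 2
  | right => 3
  | oracle => 4
  | pair c d => 4 * Nat.pair (encode c) (encode d) + 5
  | comp c d => 4 * Nat.pair (encode c) (encode d) + 6
  | prec c d => 4 * Nat.pair (encode c) (encode d) + 7
  | rfind c => 4 * encode c + 8

/-- The program with a given Gödel number. -/
def ofNat : ℕ → OracleCode
  | 0 => zero
  | 1 => succ
  | 2 => left
  | 3 => right
  | 4 => oracle
  | n + 5 =>
    have hm : n / 4 < n + 5 := by omega
    have _h1 : (n / 4).unpair.1 < n + 5 := lt_of_le_of_lt (Nat.unpair_left_le _) hm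
    have _h2 : (n / 4).unpair.2 < n + 5 := lt_of_le_of_lt (Nat.unpair_right_le _) hm
    match n % 4 with
    | 0 => pair (ofNat (n / 4).unpair.1) (ofNat (n / 4).unpair.2)
    | 1 => comp (ofNat (n / 4).unpair.1) (ofNat (n / 4).unpair.2)
    | 2 => prec (ofNat (n / 4).unpair.1) (ofNat (n / 4).unpair.2)
    | _ => rfind (ofNat (n / 4))
  termination_by n => n

theorem ofNat_encode (c : OracleCode) : ofNat (encode c) = c := by
  induction c with
  | zero | succ | left | right | oracle => simp [encode, ofNat]
  | pair c d hc hd =>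
    have h1 : 4 * Nat.pair (encode c) (encode d) / 4 = Nat.pair (encode c) (encode d) := by omega
    have h2 : 4 * Nat.pair (encode c) (encode d) % 4 = 0 := by omega
    simp [encode, ofNat, hc, hd]
  | comp c d hc hd =>
    have h1 : (4 * Nat.pair (encode c) (encode d) + 1) / 4
        = Nat.pair (encode c) (encode d) := by omega
    have h2 : (4 * Nat.pair (encode c) (encode d) + 1) % 4 = 1 := by omega
    simp [encode, ofNat, h1, h2, hc, hd]
  | prec c d hc hd =>
    have h1 : (4 * Nat.pair (encode c) (encode d) + 2) / 4
        = Nat.pair (encode c) (encode d) := by omega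
    have h2 : (4 * Nat.pair (encode c) (encode d) + 2) % 4 = 2 := by omega
    simp [encode, ofNat, h1, h2, hc, hd]
  | rfind c hc =>
    have h1 : (4 * encode c + 3) / 4 = encode c := by omega
    have h2 : (4 * encode c + 3) % 4 = 3 := by omega
    simp [encode, ofNat, h1, h2, hc]

/-- The programs with oracle `g` compute exactly the partial functions recursive in `g`. -/
theorem turingReducible_iff_exists_eval {f g : ℕ →. ℕ} :
    TuringReducible f g ↔ ∃ c : OracleCode, eval g c = f := by
  rw [TuringReducible, RecursiveIn.iff_nat]
  constructor
  · intro h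
    induction h with
    | zero => exact ⟨zero, rfl⟩
    | succ => exact ⟨succ, rfl⟩
    | left => exact ⟨left, rfl⟩
    | right => exact ⟨right, rfl⟩
    | oracle k hk => exact ⟨oracle, (Set.mem_singleton_iff.1 hk).symm⟩
    | pair _ _ hf hh =>
      obtain ⟨c, rfl⟩ := hf
      obtain ⟨d, rfl⟩ := hh
      exact ⟨pair c d, rfl⟩
    | comp _ _ hf hh =>
      obtain ⟨c, rfl⟩ := hf
      obtain ⟨d, rfl⟩ := hh
      exact ⟨comp c d, rfl⟩
    | prec _ _ hf hh =>
      obtain ⟨c, rfl⟩ := hf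
      obtain ⟨d, rfl⟩ := hh
      exact ⟨prec c d, rfl⟩
    | rfind _ hf =>
      obtain ⟨c, rfl⟩ := hf
      exact ⟨rfind c, rfl⟩
  · rintro ⟨c, rfl⟩
    induction c with
    | zero => exact .zero
    | succ => exact .succ
    | left => exact .left
    | right => exact .right
    | oracle => exact .oracle g rfl
    | pair c d hc hd => exact .pair hc hd
    | comp c d hc hd => exact .comp hc hd
    | prec c d hc hd => exact .prec hc hd
    | rfind c hc => exact .rfind hc

end OracleCode

/-- The characteristic function of a set of natural numbers, as an oracle. -/
noncomputable def charFun (X : Set ℕ) : ℕ →. ℕ :=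
  fun n => Part.some (X.indicator (fun _ => 1) n)

/-- Turing equivalence `X ≡_T Y` of sets of natural numbers. -/
def SetTuringEquivalent (X Y : Set ℕ) : Prop :=
  TuringEquivalent (charFun X) (charFun Y)

/-- The Turing jump `X' = {n | Φ_n^X(n)↓}`, where `Φ_n` is the program with Gödel number `n`. -/
def turingJump (X : Set ℕ) : Set ℕ :=
  {n | (OracleCode.eval (charFun X) (OracleCode.ofNat n) n).Dom}

/-- The join `X ⊕ Y = {2n | n ∈ X} ∪ {2n + 1 | n ∈ Y}`. -/
def setJoin (X Y : Set ℕ) : Set ℕ :=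
  {m | (∃ n ∈ X, m = 2 * n) ∨ ∃ n ∈ Y, m = 2 * n + 1}

/-- `G` is homogeneous for the `k`-colouring `c` of the natural numbers (of their
singletons): `c` is constant on `G`. -/
def IsHomogeneousFor {k : ℕ} (c : ℕ → Fin k) (G : Set ℕ) : Prop :=
  ∃ i : Fin k, ∀ x ∈ G, c x = i

/-!
The set `G` is built by forcing with low reservoirs. If some infinite low set misses one of the
two colours, it is homogeneous, and it is generalized low because it is low. So assume that every
infinite low set meets both colours. Two homogeneous sets, one for each colour ("side"), are built
simultaneously by finite approximations, all future elements being taken from a reservoir `X` that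
is infinite and low. At each stage one program is given for each side, and for one of the two sides
the question whether its program halts on its own index is settled (`exists_forcing_step`).
Enumerating all pairs of programs, one of the sides has all its programs settled.

To settle a question, consider partitions of the part of the reservoir above some number `b` into
two sides. Either some partition makes the program of each side diverge on all subsets of that side;
then there is such a partition computable in an oracle of PA degree over `X`, and the reservoir is
thinned to an infinite side. Or, for every bound, compactness yields a finite interval on which
every partition, in particular the given colouring, contains a finite set making a program halt.
Low oracles of PA degree over low sets exist by the low basis theorem (`low_basis`,
`exists_low_pa`), so reservoirs stay low.

It remains to make the construction recoverable from `G` and the halting problem. Each reservoir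
comes with a function `D` that is generic, and jointly low, over the oracle of PA degree
(`exists_low_generic`, `CodesFor`). Genericity gives two things. Each value of `D` is taken on an
infinite low part of the reservoir; as such parts meet both colours, an element with a prescribed
message can be added to each side. And in the second case above the interval can be chosen such that
`D` is constant on it and announces its right end, so that a reader who meets the finite set used
there can skip it without knowing it. The message added at the end of a stage names an index,
relative to the halting problem, of the function `D` of the next stage, together with the outcome of
the stage. So the oracle `G ⊕ ∅'` can replay the construction (`Condition.Step.exists_decodeStep`)
and read off the jump of `G` (`decIn_turingJump_of_steps`).

Computability relative to a total oracle is handled through a universal functional `run` with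
finite oracles, obtained by hard-wiring the finite oracle into Mathlib's oracle-free programs; it
gives the use principle, an index theorem, and the effectiveness of all searches.
-/

open Encodable

/-! ### Closure properties of relative computability -/

section Closure

variable {α β γ σ : Type*} [Primcodable α] [Primcodable β] [Primcodable γ] [Primcodable σ]
variable {O : Set (ℕ →. ℕ)}

theorem Nat.RecursiveIn.some : Nat.RecursiveIn O Part.some :=
  Nat.Partrec.some.recursiveIn

theorem Nat.RecursiveIn.prec' {f g h : ℕ →. ℕ} (hf : Nat.RecursiveIn O f)
    (hg : Nat.RecursiveIn O g) (hh : Nat.RecursiveIn O h) :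
    Nat.RecursiveIn O fun a => (f a).bind fun n => n.rec (g a) fun y IH =>
      IH.bind fun i => h (Nat.pair a (Nat.pair y i)) :=
  ((Nat.RecursiveIn.prec hg hh).comp (.pair .some hf)).of_eq fun a =>
    Part.ext fun s => by simp [Seq.seq]

namespace RecursiveIn

theorem comp {f : β →. σ} {g : α → β} (hf : RecursiveIn O f) (hg : ComputableIn O g) :
    RecursiveIn O fun a => f (g a) :=
  (Nat.RecursiveIn.comp hf hg).of_eq fun n => by
    rcases e : decode (α := α) n with - | a <;> simp [encodek]

theorem bind {f : α →. β} {g : α → β →. σ} (hf : RecursiveIn O f) (hg : RecursiveIn₂ O g) :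
    RecursiveIn O fun a => (f a).bind (g a) :=
  (Nat.RecursiveIn.comp hg (.pair .some hf)).of_eq fun n => by
    rcases e : decode (α := α) n with - | a
    · simp [Seq.seq]
    · simp only [Seq.seq, e, encodek, Part.coe_some, Part.bind_some, Part.bind_map,
        Part.map_some, Part.bind_eq_bind, Part.map_eq_map, Part.map_map, Function.comp_apply,
        decode_prod_val, Nat.unpair_pair, Option.bind_some, Option.map_some]
      exact (Part.map_bind _ _ _).symm

theorem map {f : α →. β} {g : α → β → σ} (hf : RecursiveIn O f) (hg : ComputableIn₂ O g) :
    RecursiveIn O fun a => (f a).map (g a) := by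
  have h := bind (g := fun a x => Part.some (g a x)) hf hg
  simpa [Part.bind_some_eq_map] using h

theorem nat_rec {f : α → ℕ} {g : α →. σ} {h : α → ℕ × σ →. σ} (hf : ComputableIn O f)
    (hg : RecursiveIn O g) (hh : RecursiveIn₂ O h) :
    RecursiveIn O fun a => (f a).rec (g a) fun y IH => IH.bind fun i => h a (y, i) :=
  (Nat.RecursiveIn.prec' hf hg hh).of_eq fun n => by
    rcases e : decode (α := α) n with - | a
    · simp
    · simp only [Part.coe_some, Part.bind_some]
      induction f a <;> simp_all

theorem rfind {p : α → ℕ →. Bool} (hp : RecursiveIn₂ O p) :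
    RecursiveIn O fun a => Nat.rfind (p a) :=
  (Nat.RecursiveIn.rfind <| RecursiveIn.map hp
    (g := fun (_ : α × ℕ) (b : Bool) => cond b 0 1) (Primrec.computableIn
    ((Primrec.dom_bool fun b => cond b 0 1).comp Primrec.snd))).of_eq fun n => by
    rcases e : decode (α := α) n with - | a
    · simpa [e] using Nat.rfind_zero_none (fun _ => Part.none) rfl
    · have h : ∀ b : Bool, ((fun m => decide (m = 0)) ∘ encode ∘ fun b : Bool => cond b 0 1) b = b :=
        fun b => by cases b <;> rfl
      simp [e, Part.map_map, Part.map_id']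

end RecursiveIn

namespace ComputableIn

theorem comp {f : β → σ} {g : α → β} (hf : ComputableIn O f) (hg : ComputableIn O g) :
    ComputableIn O fun a => f (g a) :=
  RecursiveIn.comp (f := fun b => Part.some (f b)) hf hg

theorem pair {f : α → β} {g : α → γ} (hf : ComputableIn O f) (hg : ComputableIn O g) :
    ComputableIn O fun a => (f a, g a) :=
  (Nat.RecursiveIn.pair hf hg).of_eq fun n => by
    rcases e : decode (α := α) n <;> simp [Seq.seq]

theorem nat_rec {f : α → ℕ} {g : α → σ} {h : α → ℕ × σ → σ} (hf : ComputableIn O f)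
    (hg : ComputableIn O g) (hh : ComputableIn₂ O h) :
    ComputableIn O fun a =>
      Nat.rec (motive := fun _ => σ) (g a) (fun y IH => h a (y, IH)) (f a) :=
  (RecursiveIn.nat_rec (g := fun a => Part.some (g a)) (h := fun a p => Part.some (h a p))
    hf hg hh).of_eq fun a => by
    have H : ∀ n, Nat.rec (motive := fun _ => Part σ) (Part.some (g a))
        (fun y IH => IH.bind fun i => Part.some (h a (y, i))) n =
        Part.some (Nat.rec (motive := fun _ => σ) (g a) (fun y IH => h a (y, IH)) n) := by
      intro n
      induction n with
      | zero => rfl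
      | succ n ih => simp [ih]
    exact H (f a)

theorem of_eq {f g : α → σ} (hf : ComputableIn O f) (H : ∀ n, f n = g n) : ComputableIn O g :=
  (funext H : f = g) ▸ hf

/-- Unbounded search for the first value of a computable sequence of options. -/
theorem rfindOpt {f : α → ℕ → Option σ} (hf : ComputableIn₂ O f) :
    RecursiveIn O fun a => Nat.rfindOpt (f a) :=
  RecursiveIn.bind (RecursiveIn.rfind (p := fun a n => Part.some (f a n).isSome)
    ((Primrec.option_isSome.computableIn).comp hf))
    (RecursiveIn.comp (f := fun o : Option σ => (o : Part σ))
      (Computable.ofOption Computable.id).recursiveIn hf)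

end ComputableIn

end Closure

/-- The oracle given by a total function. -/
abbrev orc (g : ℕ → ℕ) : Set (ℕ →. ℕ) := {(g : ℕ →. ℕ)}

theorem computableIn_orc_self (g : ℕ → ℕ) : ComputableIn (orc g) g :=
  RecursiveIn.oracle (g : ℕ →. ℕ) rfl

theorem RecursiveIn.trans_orc {α σ : Type*} [Primcodable α] [Primcodable σ] {f : α →. σ}
    {g h : ℕ → ℕ} (hf : RecursiveIn (orc g) f) (hg : ComputableIn (orc h) g) :
    RecursiveIn (orc h) f :=
  hf.subst (by rintro _ rfl; exact hg)

theorem ComputableIn.trans_orc {α σ : Type*} [Primcodable α] [Primcodable σ] {f : α → σ}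
    {g h : ℕ → ℕ} (hf : ComputableIn (orc g) f) (hg : ComputableIn (orc h) g) :
    ComputableIn (orc h) f :=
  RecursiveIn.trans_orc (f := fun a => Part.some (f a)) hf hg

/-- The initial segment `[g 0, …, g (k - 1)]` of a sequence. -/
def pre {α : Type*} (g : ℕ → α) (k : ℕ) : List α := (List.range k).map g

section Pre

variable {α : Type*}

@[simp] theorem length_pre (g : ℕ → α) (k : ℕ) : (pre g k).length = k := by simp [pre]

theorem pre_succ (g : ℕ → α) (k : ℕ) : pre g (k + 1) = pre g k ++ [g k] := by
  simp [pre, List.range_succ]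

theorem getElem?_pre (g : ℕ → α) (k i : ℕ) : (pre g k)[i]? = if i < k then some (g i) else none := by
  by_cases h : i < k <;> simp [pre, h]

theorem take_pre (g : ℕ → α) {j k : ℕ} (h : j ≤ k) : (pre g k).take j = pre g j := by
  apply List.ext_getElem? fun i => ?_
  rw [List.getElem?_take, getElem?_pre, getElem?_pre]
  split_ifs <;> first | rfl | omega

theorem pre_prefix (g : ℕ → α) {j k : ℕ} (h : j ≤ k) : pre g j <+: pre g k := by
  rw [← take_pre g h]; exact List.take_prefix _ _

theorem pre_congr {g h : ℕ → α} {k : ℕ} (H : ∀ i < k, g i = h i) : pre g k = pre h k :=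
  List.map_congr_left fun i hi => H i (List.mem_range.1 hi)

theorem computableIn_pre {O : Set (ℕ →. ℕ)} [Primcodable α] {g : ℕ → α} (hg : ComputableIn O g) :
    ComputableIn O (pre g) := by
  have h₁ : ComputableIn O fun p : ℕ × ℕ × List α => (p.2.2, g p.2.1) :=
    .pair ((Primrec.snd.comp Primrec.snd).computableIn)
      (hg.comp (Primrec.fst.comp Primrec.snd).computableIn)
  have h₂ : ComputableIn O fun q : List α × α => q.1 ++ [q.2] :=
    Primrec.list_concat.computableIn
  have h : ComputableIn₂ O fun (_ : ℕ) (p : ℕ × List α) => p.2 ++ [g p.1] := h₂.comp h₁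
  have h' : ComputableIn O fun n : ℕ =>
      Nat.rec (motive := fun _ => List α) [] (fun y IH => IH ++ [g y]) n :=
    ComputableIn.nat_rec (f := fun n => n) (g := fun _ => [])
      (h := fun _ p => p.2 ++ [g p.1]) .id (.const _) h
  refine h'.of_eq fun n => ?_
  induction n with
  | zero => rfl
  | succ n ih => rw [pre_succ, ← ih]

end Pre

/-! ### A universal oracle functional -/

namespace OracleCode

open Nat.Partrec (Code)

/-- The partial function with finite domain whose graph is listed by `l`. -/
def ofList (l : List ℕ) : ℕ →. ℕ := fun n => (l[n]? : Part ℕ)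

theorem exists_lookup_code :
    ∃ c : Code, ∀ (l : List ℕ) (n : ℕ), c.eval (Nat.pair (Encodable.encode l) n) = ofList l n := by
  have h : Partrec fun p : List ℕ × ℕ => (p.1[p.2]? : Part ℕ) :=
    Computable.ofOption (Primrec.list_getElem?.comp Primrec.fst Primrec.snd).to_comp
  obtain ⟨c, hc⟩ := Code.exists_code.1 h
  refine ⟨c, fun l n => ?_⟩
  rw [hc]
  simp
  exact Part.map_id' (fun _ => rfl) _

/-- The oracle-free program obtained from a program with oracle by hard-wiring the finite
oracle `l`: queries outside the domain of `l` diverge. -/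
noncomputable def hardwire (l : List ℕ) : OracleCode → Code
  | zero => Code.zero
  | succ => Code.succ
  | left => Code.left
  | right => Code.right
  | oracle => Code.curry exists_lookup_code.choose (Encodable.encode l)
  | pair c d => Code.pair (hardwire l c) (hardwire l d)
  | comp c d => Code.comp (hardwire l c) (hardwire l d)
  | prec c d => Code.prec (hardwire l c) (hardwire l d)
  | rfind c => Code.comp (Code.rfind' (hardwire l c)) (Code.pair Code.id Code.zero)

theorem eval_hardwire (l : List ℕ) (c : OracleCode) :
    (hardwire l c).eval = eval (ofList l) c := by
  induction c with
  | zero | succ | left | right => rfl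
  | oracle =>
    funext n
    simp [hardwire, Code.eval_curry, exists_lookup_code.choose_spec, eval]
  | pair c d hc hd => simp only [hardwire, Code.eval, eval, hc, hd]; rfl
  | comp c d hc hd => simp only [hardwire, Code.eval, eval, hc, hd]; rfl
  | prec c d hc hd => simp only [hardwire, Code.eval, eval, hc, hd]; rfl
  | rfind c hc =>
    funext n
    have h : Code.eval (Code.pair Code.id Code.zero) n = Part.some (Nat.pair n 0) := by
      simp [Code.eval, Code.eval_id, Seq.seq, pure, PFun.pure]
    simp only [hardwire, Code.eval, hc] at h ⊢
    rw [h]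
    simp [eval, Part.map_id']

theorem primrec_hardwire : Primrec₂ fun (l : List ℕ) (n : ℕ) => hardwire l (ofNat n) := by
  let g : List ℕ → List Code → Option Code := fun l L =>
    if L.length < 5 then
      [Code.zero, Code.succ, Code.left, Code.right,
        Code.curry exists_lookup_code.choose (Encodable.encode l)][L.length]?
    else
      L[((L.length - 5) / 4).unpair.1]?.bind fun a =>
        L[((L.length - 5) / 4).unpair.2]?.bind fun b =>
          L[(L.length - 5) / 4]?.bind fun c =>
            [Code.pair a b, Code.comp a b, Code.prec a b,
              Code.comp (Code.rfind' c) (Code.pair Code.id Code.zero)][(L.length - 5) % 4]?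
  have hg : Primrec₂ g := by
    have hlen : Primrec fun p : List ℕ × List Code => p.2.length :=
      Primrec.list_length.comp Primrec.snd
    have hsub : Primrec fun p : List ℕ × List Code => p.2.length - 5 :=
      Primrec.nat_sub.comp hlen (Primrec.const 5)
    have hdiv : Primrec fun p : List ℕ × List Code => (p.2.length - 5) / 4 :=
      Primrec.nat_div.comp hsub (Primrec.const 4)
    have hmod : Primrec fun p : List ℕ × List Code => (p.2.length - 5) % 4 :=
      Primrec.nat_mod.comp hsub (Primrec.const 4)
    refine Primrec.ite (Primrec.nat_lt.comp hlen (Primrec.const 5)) ?_ ?_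
    · refine Primrec.list_getElem?.comp ?_ hlen
      refine Primrec.list_cons.comp (Primrec.const _) <| Primrec.list_cons.comp (Primrec.const _) <|
        Primrec.list_cons.comp (Primrec.const _) <| Primrec.list_cons.comp (Primrec.const _) <|
        Primrec.list_cons.comp ?_ (Primrec.const _)
      exact Code.primrec₂_curry.comp (Primrec.const _) (Primrec.encode.comp Primrec.fst)
    · refine Primrec.option_bind (Primrec.list_getElem?.comp Primrec.snd
        (Primrec.fst.comp (Primrec.unpair.comp hdiv))) ?_
      refine Primrec.option_bind (Primrec.list_getElem?.comp (Primrec.snd.comp Primrec.fst)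
        (Primrec.snd.comp (Primrec.unpair.comp (hdiv.comp Primrec.fst)))) ?_
      refine Primrec.option_bind (Primrec.list_getElem?.comp
        (Primrec.snd.comp (Primrec.fst.comp Primrec.fst))
        (hdiv.comp (Primrec.fst.comp Primrec.fst))) ?_
      have ha : Primrec fun p : (((List ℕ × List Code) × Code) × Code) × Code => p.1.1.2 :=
        Primrec.snd.comp (Primrec.fst.comp Primrec.fst)
      have hb : Primrec fun p : (((List ℕ × List Code) × Code) × Code) × Code => p.1.2 :=
        Primrec.snd.comp Primrec.fst
      have hc : Primrec fun p : (((List ℕ × List Code) × Code) × Code) × Code => p.2 :=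
        Primrec.snd
      refine Primrec.list_getElem?.comp ?_
        (hmod.comp (Primrec.fst.comp (Primrec.fst.comp Primrec.fst)))
      exact Primrec.list_cons.comp (Code.primrec₂_pair.comp ha hb) <|
        Primrec.list_cons.comp (Code.primrec₂_comp.comp ha hb) <|
        Primrec.list_cons.comp (Code.primrec₂_prec.comp ha hb) <|
        Primrec.list_cons.comp (Code.primrec₂_comp.comp (Code.primrec_rfind'.comp hc)
          (Primrec.const _)) (Primrec.const _)
  refine Primrec.nat_strong_rec _ hg fun l n => ?_
  match n with
  | 0 | 1 | 2 | 3 | 4 => simp [g, ofNat, hardwire]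
  | n + 5 =>
    have hm : n / 4 < n + 5 := by omega
    have h1 : (n / 4).unpair.1 < n + 5 := lt_of_le_of_lt (Nat.unpair_left_le _) hm
    have h2 : (n / 4).unpair.2 < n + 5 := lt_of_le_of_lt (Nat.unpair_right_le _) hm
    have h4 : n % 4 < 4 := Nat.mod_lt _ (by omega)
    rw [ofNat]
    simp only [g, List.length_map, List.length_range, List.getElem?_map, Nat.add_sub_cancel,
      List.getElem?_range hm, List.getElem?_range h1, List.getElem?_range h2, Option.map_some,
      Option.bind_some]
    rw [if_neg (by omega)]
    generalize n % 4 = r at h4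
    interval_cases r <;> simp [hardwire]

theorem eval_mono {g h : ℕ →. ℕ} (H : ∀ n m, m ∈ g n → m ∈ h n) (c : OracleCode) :
    ∀ {n m : ℕ}, m ∈ eval g c n → m ∈ eval h c n := by
  induction c with
  | zero | succ | left | right => exact id
  | oracle => exact H _ _
  | pair c d hc hd =>
    intro n m
    simp only [eval, Seq.seq, Part.map_eq_map, Part.bind_map, Part.mem_bind_iff, Part.mem_map_iff]
    rintro ⟨a, ha, b, hb, rfl⟩
    exact ⟨a, hc ha, b, hd hb, rfl⟩
  | comp c d hc hd =>
    intro n m h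
    obtain ⟨a, ha, hb⟩ := Part.mem_bind_iff.1 h
    exact Part.mem_bind_iff.2 ⟨a, hd ha, hc hb⟩
  | prec c d hc hd =>
    intro n m
    simp only [eval]
    induction n.unpair.2 generalizing m with
    | zero => exact hc
    | succ k ih =>
      simp only [Part.bind_eq_bind, Part.mem_bind_iff]
      rintro ⟨a, ha, hb⟩
      exact ⟨a, ih ha, hd hb⟩
  | rfind c hc =>
    intro n m h
    obtain ⟨ha, hb⟩ := Nat.mem_rfind.1 h
    obtain ⟨a, ha, ha'⟩ := (Part.mem_map_iff _).1 ha
    refine Nat.mem_rfind.2 ⟨(Part.mem_map_iff _).2 ⟨a, hc ha, ha'⟩, fun hk => ?_⟩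
    obtain ⟨b, hb, hb'⟩ := (Part.mem_map_iff _).1 (hb hk)
    exact (Part.mem_map_iff _).2 ⟨b, hc hb, hb'⟩

theorem mem_ofList_pre {g : ℕ → ℕ} {k n m : ℕ} :
    m ∈ ofList (pre g k) n ↔ n < k ∧ m = g n := by
  simp only [ofList, getElem?_pre]
  split_ifs with h <;> simp [h]

/-- The use principle: a converging computation with a total oracle queries only a finite
part of the oracle. -/
theorem exists_use {g : ℕ → ℕ} (c : OracleCode) :
    ∀ {n m : ℕ}, m ∈ eval g c n → ∃ k, m ∈ eval (ofList (pre g k)) c n := by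
  have mono : ∀ {c : OracleCode} {j k n m : ℕ}, j ≤ k → m ∈ eval (ofList (pre g j)) c n →
      m ∈ eval (ofList (pre g k)) c n := fun hjk => eval_mono (fun a b => by
    rw [mem_ofList_pre, mem_ofList_pre]; exact fun h => ⟨h.1.trans_le hjk, h.2⟩) _
  induction c with
  | zero | succ | left | right => exact fun h => ⟨0, h⟩
  | oracle =>
    intro n m h
    refine ⟨n + 1, mem_ofList_pre.2 ⟨n.lt_succ_self, ?_⟩⟩
    exact Part.mem_some_iff.1 h
  | pair c d hc hd =>
    intro n m
    simp only [eval, Seq.seq, Part.map_eq_map, Part.bind_map, Part.mem_bind_iff, Part.mem_map_iff]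
    rintro ⟨a, ha, b, hb, rfl⟩
    obtain ⟨k₁, h₁⟩ := hc ha
    obtain ⟨k₂, h₂⟩ := hd hb
    exact ⟨max k₁ k₂, a, mono (le_max_left _ _) h₁, b, mono (le_max_right _ _) h₂, rfl⟩
  | comp c d hc hd =>
    intro n m h
    obtain ⟨a, ha, hb⟩ := Part.mem_bind_iff.1 h
    obtain ⟨k₁, h₁⟩ := hd ha
    obtain ⟨k₂, h₂⟩ := hc hb
    exact ⟨max k₁ k₂, Part.mem_bind_iff.2
      ⟨a, mono (le_max_left _ _) h₁, mono (le_max_right _ _) h₂⟩⟩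
  | prec c d hc hd =>
    intro n
    have mono' : ∀ {j k m : ℕ}, j ≤ k → m ∈ eval (ofList (pre g j)) (prec c d) n →
        m ∈ eval (ofList (pre g k)) (prec c d) n := mono
    simp only [eval] at mono' ⊢
    have key : ∀ (i : ℕ) {m : ℕ}, m ∈ (Nat.rec (motive := fun _ => Part ℕ)
          (eval g c n.unpair.1) (fun y IH => IH >>= fun i =>
            eval g d (Nat.pair n.unpair.1 (Nat.pair y i))) i) →
        ∃ k, ∀ k' ≥ k, m ∈ (Nat.rec (motive := fun _ => Part ℕ)
          (eval (ofList (pre g k')) c n.unpair.1) (fun y IH => IH >>= fun i =>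
            eval (ofList (pre g k')) d (Nat.pair n.unpair.1 (Nat.pair y i))) i) := by
      intro i
      induction i with
      | zero =>
        intro m h
        obtain ⟨k, hk⟩ := hc h
        exact ⟨k, fun k' hk' => mono hk' hk⟩
      | succ i ih =>
        intro m
        simp only [Part.bind_eq_bind, Part.mem_bind_iff]
        rintro ⟨a, ha, hb⟩
        obtain ⟨k₁, h₁⟩ := ih ha
        obtain ⟨k₂, h₂⟩ := hd hb
        exact ⟨max k₁ k₂, fun k' hk' => ⟨a, h₁ k' ((le_max_left _ _).trans hk'),
          mono ((le_max_right _ _).trans hk') h₂⟩⟩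
    intro m h
    obtain ⟨k, hk⟩ := key _ h
    exact ⟨k, hk k le_rfl⟩
  | rfind c hc =>
    intro n m h
    obtain ⟨ha, hb⟩ := Nat.mem_rfind.1 h
    obtain ⟨a, ha, ha'⟩ := (Part.mem_map_iff _).1 ha
    obtain ⟨k, hk⟩ := hc ha
    have : ∀ i : ℕ, ∃ k, i < m → ∃ b, b ∈ eval (ofList (pre g k)) c (Nat.pair n i) ∧
        decide (b = 0) = false := by
      intro i
      by_cases hi : i < m
      · obtain ⟨b, hb, hb'⟩ := (Part.mem_map_iff _).1 (hb hi)
        obtain ⟨k, hk⟩ := hc hb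
        exact ⟨k, fun _ => ⟨b, hk, hb'⟩⟩
      · exact ⟨0, fun h => absurd h hi⟩
    choose f hf using this
    refine ⟨max k ((Finset.range m).sup f), Nat.mem_rfind.2
      ⟨(Part.mem_map_iff _).2 ⟨a, mono (le_max_left _ _) hk, ha'⟩, fun {i} hi => ?_⟩⟩
    obtain ⟨b, hb, hb'⟩ := hf i hi
    exact (Part.mem_map_iff _).2 ⟨b, mono ((Finset.le_sup (f := f) (Finset.mem_range.2 hi)).trans
      (le_max_right _ _)) hb, hb'⟩

/-- Search through the first `j` pairs (length of the oracle part, number of steps) for a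
converging computation of program `c` on input `n`. -/
noncomputable def runAux (c : ℕ) (l : List ℕ) (n : ℕ) : ℕ → Option ℕ
  | 0 => none
  | j + 1 => runAux c l n j <|>
      Code.evaln j.unpair.2 (hardwire (l.take j.unpair.1) (ofNat c)) n

/-- The universal functional: the result, if any, found by running program `c` on input `n`
with the finite oracle `l` for a number of steps bounded by the length of `l`. The result does
not change when `l` is prolonged. -/
noncomputable def run (c : ℕ) (l : List ℕ) (n : ℕ) : Option ℕ := runAux c l n (l.length + 1)

theorem primrec_run : Primrec fun p : ℕ × List ℕ × ℕ => run p.1 p.2.1 p.2.2 := by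
  have h : Primrec₂ fun (p : ℕ × List ℕ × ℕ) (q : ℕ × Option ℕ) =>
      (q.2 <|> Code.evaln q.1.unpair.2
        (hardwire (p.2.1.take q.1.unpair.1) (ofNat p.1)) p.2.2 : Option ℕ) := by
    have hj : Primrec fun r : (ℕ × List ℕ × ℕ) × ℕ × Option ℕ => r.2.1.unpair :=
      Primrec.unpair.comp (Primrec.fst.comp Primrec.snd)
    refine Primrec.option_orElse.comp (Primrec.snd.comp Primrec.snd) ?_
    refine Code.primrec_evaln.comp (.pair (.pair (Primrec.snd.comp hj) ?_)
      (Primrec.snd.comp (Primrec.snd.comp Primrec.fst)))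
    exact primrec_hardwire.comp (Primrec.list_take.comp (Primrec.fst.comp hj)
      (Primrec.fst.comp (Primrec.snd.comp Primrec.fst))) (Primrec.fst.comp Primrec.fst)
  refine (Primrec.nat_rec' (f := fun p : ℕ × List ℕ × ℕ => p.2.1.length + 1)
    (Primrec.succ.comp (Primrec.list_length.comp (Primrec.fst.comp Primrec.snd)))
    (Primrec.const none) h).of_eq fun p => ?_
  unfold run
  generalize p.2.1.length + 1 = k
  induction k with
  | zero => rfl
  | succ k ih => rw [runAux, ← ih]

theorem runAux_mono {c n m j k : ℕ} {l : List ℕ} (h : j ≤ k) (hm : runAux c l n j = some m) :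
    runAux c l n k = some m := by
  induction k, h using Nat.le_induction with
  | base => exact hm
  | succ k _ ih => simp [runAux, ih]

theorem runAux_append (c n : ℕ) (l l' : List ℕ) {j : ℕ} (hj : j ≤ l.length + 1) :
    runAux c (l ++ l') n j = runAux c l n j := by
  induction j with
  | zero => rfl
  | succ j ih =>
    have := Nat.unpair_left_le j
    rw [runAux, runAux, ih (by omega), List.take_append_of_le_length (by omega)]

theorem run_mono {c n m : ℕ} {l l' : List ℕ} (h : l <+: l') (hm : run c l n = some m) :
    run c l' n = some m := by
  obtain ⟨t, rfl⟩ := h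
  rw [run, ← runAux_append c n l t le_rfl] at hm
  exact runAux_mono (by simp) hm

theorem eval_of_runAux {g : ℕ → ℕ} {c k n j m : ℕ} (h : runAux c (pre g k) n j = some m) :
    m ∈ eval g (ofNat c) n := by
  induction j with
  | zero => simp [runAux] at h
  | succ j ih =>
    rw [runAux] at h
    rcases e : runAux c (pre g k) n j with - | b
    · rw [e] at h
      have h' := Code.evaln_sound (Option.mem_def.2 (by simpa using h))
      rw [eval_hardwire] at h'
      refine eval_mono (fun a b hb => ?_) _ h'
      rw [ofList, List.getElem?_take, getElem?_pre] at hb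
      split_ifs at hb <;> simp_all
    · rw [e] at h
      exact ih (by rw [e]; simpa using h)

/-- The universal functional computes the functional of each program. -/
theorem mem_eval_iff_run {g : ℕ → ℕ} {c n m : ℕ} :
    m ∈ eval g (ofNat c) n ↔ ∃ k, run c (pre g k) n = some m := by
  refine ⟨fun h => ?_, fun ⟨k, hk⟩ => eval_of_runAux hk⟩
  obtain ⟨k, hk⟩ := exists_use _ h
  rw [← eval_hardwire, Code.evaln_complete] at hk
  obtain ⟨s, hs⟩ := hk
  have hsome : ∃ m', runAux c (pre g (Nat.pair k s)) n (Nat.pair k s + 1) = some m' := by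
    rw [Option.mem_def] at hs
    rw [runAux, Nat.unpair_pair, take_pre g (Nat.left_le_pair k s), hs]
    cases runAux c (pre g (Nat.pair k s)) n (Nat.pair k s) <;> simp
  obtain ⟨m', h'⟩ := hsome
  exact ⟨Nat.pair k s, by rw [run, length_pre, h', Part.mem_unique (eval_of_runAux h') h]⟩

end OracleCode

/-! ### Semidecidable predicates, indices and lowness -/

section Semidecidable

variable {α β : Type*} [Primcodable α] [Primcodable β]

/-- `p` is semidecidable relative to `g`: it is the domain of a partial function recursive
in `g`. -/
def SemiIn (g : ℕ → ℕ) (p : α → Prop) : Prop :=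
  ∃ f : α →. ℕ, RecursiveIn (orc g) f ∧ ∀ a, p a ↔ (f a).Dom

/-- `p` is decidable relative to `g`. -/
def DecIn (g : ℕ → ℕ) (p : α → Prop) : Prop :=
  ∃ d : α → Bool, ComputableIn (orc g) d ∧ ∀ a, p a ↔ d a = true

theorem DecIn.trans {g h : ℕ → ℕ} {p : α → Prop} (hp : DecIn g p) (hg : ComputableIn (orc h) g) :
    DecIn h p :=
  hp.imp fun _ hd => ⟨hd.1.trans_orc hg, hd.2⟩

theorem SemiIn.trans {g h : ℕ → ℕ} {p : α → Prop} (hp : SemiIn g p)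
    (hg : ComputableIn (orc h) g) : SemiIn h p :=
  hp.imp fun _ hf => ⟨hf.1.trans_orc hg, hf.2⟩

theorem DecIn.comp {g : ℕ → ℕ} {p : β → Prop} (hp : DecIn g p) {f : α → β}
    (hf : ComputableIn (orc g) f) : DecIn g fun a => p (f a) := by
  obtain ⟨d, hd, hp⟩ := hp
  exact ⟨fun a => d (f a), hd.comp hf, fun a => hp _⟩

theorem SemiIn.comp {g : ℕ → ℕ} {p : β → Prop} (hp : SemiIn g p) {f : α → β}
    (hf : ComputableIn (orc g) f) : SemiIn g fun a => p (f a) := by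
  obtain ⟨d, hd, hp⟩ := hp
  exact ⟨fun a => d (f a), hd.comp hf, fun a => hp _⟩

theorem PrimrecPred.decIn {g : ℕ → ℕ} {p : α → Prop} (hp : PrimrecPred p) : DecIn g p := by
  obtain ⟨_, hp⟩ := hp
  exact ⟨_, hp.computableIn, fun a => by simp⟩

theorem DecIn.and {g : ℕ → ℕ} {p q : α → Prop} (hp : DecIn g p) (hq : DecIn g q) :
    DecIn g fun a => p a ∧ q a := by
  obtain ⟨d, hd, hp⟩ := hp
  obtain ⟨d', hd', hq⟩ := hq
  have h₁ : ComputableIn (orc g) fun r : Bool × Bool => r.1 && r.2 := Primrec.and.computableIn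
  have h₂ := h₁.comp (hd.pair hd')
  exact ⟨_, h₂, fun a => by simp [hp, hq]⟩

theorem DecIn.exists {g : ℕ → ℕ} {p : α × ℕ → Prop} (hp : DecIn g p) :
    SemiIn g fun a => ∃ k, p (a, k) := by
  obtain ⟨d, hd, hp⟩ := hp
  refine ⟨fun a => Nat.rfind fun k => Part.some (d (a, k)),
    RecursiveIn.rfind (p := fun a k => Part.some (d (a, k))) hd, fun a => ?_⟩
  refine Iff.trans ?_ Nat.rfind_dom.symm
  exact exists_congr fun k => (hp _).trans ⟨fun h => ⟨Part.mem_some_iff.2 h.symm, fun _ => trivial⟩,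
    fun h => (Part.mem_some_iff.1 h.1).symm⟩

theorem DecIn.semiIn {g : ℕ → ℕ} {p : α → Prop} (hp : DecIn g p) : SemiIn g p := by
  have h := (hp.comp (Primrec.fst (α := α) (β := ℕ)).computableIn).exists
  simpa using h

/-- A predicate of the form `∃ k, W (a, g ↾ k)` with `W` primitive recursive. -/
theorem SemiIn.of_pre {g : ℕ → ℕ} {W : α × List ℕ → Prop} (hW : PrimrecPred W) :
    SemiIn g fun a => ∃ k, W (a, pre g k) :=
  (hW.decIn.comp (f := fun q : α × ℕ => (q.1, pre g q.2)) (Primrec.fst.computableIn.pair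
    ((computableIn_pre (computableIn_orc_self g)).comp Primrec.snd.computableIn))).exists

end Semidecidable

namespace OracleCode

variable {α β : Type*} [Primcodable α] [Primcodable β]

/-- The program with Gödel number `c` halts on input `n` with oracle `g`. -/
def Halts (g : ℕ → ℕ) (c n : ℕ) : Prop := (eval g (ofNat c) n).Dom

theorem halts_iff_run {g : ℕ → ℕ} {c n : ℕ} :
    Halts g c n ↔ ∃ k, (run c (pre g k) n).isSome := by
  simp only [Halts, Part.dom_iff_mem, mem_eval_iff_run, Option.isSome_iff_exists]
  exact exists_comm

theorem recursiveIn_eval (g : ℕ → ℕ) :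
    RecursiveIn₂ (orc g) fun c n => eval g (ofNat c) n := by
  have h₁ : ComputableIn (orc g) fun q : (ℕ × ℕ) × ℕ => pre g q.2 :=
    (computableIn_pre (computableIn_orc_self g)).comp Primrec.snd.computableIn
  have h₂ : ComputableIn (orc g) fun q : (ℕ × ℕ) × ℕ => (q.1.1, pre g q.2, q.1.2) :=
    .pair (Primrec.fst.comp Primrec.fst).computableIn
      (.pair h₁ (Primrec.snd.comp Primrec.fst).computableIn)
  have h₃ : ComputableIn (orc g) fun q : ℕ × List ℕ × ℕ => run q.1 q.2.1 q.2.2 :=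
    primrec_run.computableIn
  have h : ComputableIn₂ (orc g) fun (p : ℕ × ℕ) k => run p.1 (pre g k) p.2 := by
    have h₄ := h₃.comp h₂
    exact h₄
  refine (ComputableIn.rfindOpt (f := fun (p : ℕ × ℕ) k => run p.1 (pre g k) p.2) h).of_eq
    fun p => Part.ext fun m => ?_
  refine Iff.trans ?_ mem_eval_iff_run.symm
  exact Nat.rfindOpt_mono (f := fun k => run p.1 (pre g k) p.2)
    fun hmn ha => run_mono (pre_prefix g hmn) ha

theorem semiIn_halts (g : ℕ → ℕ) : SemiIn g fun p : ℕ × ℕ => Halts g p.1 p.2 :=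
  ⟨_, recursiveIn_eval g, fun _ => Iff.rfl⟩

/-- The program that outputs `n` on every input. -/
def const : ℕ → OracleCode
  | 0 => zero
  | n + 1 => comp succ (const n)

theorem eval_const (g : ℕ →. ℕ) (n m : ℕ) : eval g (const n) m = Part.some n := by
  induction n with
  | zero => rfl
  | succ n ih =>
    change (eval g (const n) m).bind (eval g succ) = _
    rw [ih]
    exact Part.bind_some _ _

/-- The Gödel number of the program `m ↦ e (pair n m)`. -/
def curryIndex (e : OracleCode) (n : ℕ) : ℕ := encode (comp e (pair (const n) (pair left right)))

theorem eval_curryIndex (g : ℕ →. ℕ) (e : OracleCode) (n m : ℕ) :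
    eval g (ofNat (curryIndex e n)) m = eval g e (Nat.pair n m) := by
  have h : eval g (pair (const n) (pair left right)) m = Part.some (Nat.pair n m) := by
    simp [eval, eval_const, Seq.seq]
  rw [curryIndex, ofNat_encode]
  change (eval g _ m).bind (eval g e) = _
  rw [h]
  exact Part.bind_some _ _

theorem primrec_curryIndex (e : OracleCode) : Primrec (curryIndex e) := by
  have hnode : ∀ i, Primrec₂ fun a b => 4 * Nat.pair a b + i := fun i =>
    Primrec.nat_add.comp (Primrec.nat_mul.comp (Primrec.const 4) Primrec₂.natPair) (Primrec.const i)
  have hconst : Primrec fun n => encode (const n) := by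
    refine (Primrec.nat_rec₁ (f := fun _ r => 4 * Nat.pair 1 r + 6) 0
      ((hnode 6).comp (Primrec.const 1) Primrec.snd)).of_eq fun n => ?_
    induction n with
    | zero => rfl
    | succ n ih => rw [const, encode, ← ih]; rfl
  exact (hnode 6).comp (Primrec.const _) ((hnode 5).comp hconst (Primrec.const _))

theorem exists_eval_eq {g : ℕ → ℕ} {f : ℕ →. ℕ} (hf : RecursiveIn (orc g) f) :
    ∃ e : OracleCode, eval g e = f :=
  turingReducible_iff_exists_eval.1 hf

/-- The `s`-`m`-`n` theorem for semidecidable relations. -/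
theorem exists_index₂ {g : ℕ → ℕ} {p : α × β → Prop} (hp : SemiIn g p) :
    ∃ s : α → ℕ, Primrec s ∧ ∀ a b, p (a, b) ↔ Halts g (s a) (Encodable.encode b) := by
  obtain ⟨f, hf, hp⟩ := hp
  obtain ⟨e, he⟩ := exists_eval_eq (RecursiveIn.iff_nat.2 hf)
  refine ⟨fun a => curryIndex e (Encodable.encode a),
    (primrec_curryIndex e).comp Primrec.encode, fun a b => ?_⟩
  rw [Halts, eval_curryIndex, he, hp]
  simp

theorem exists_index {g : ℕ → ℕ} {p : α → Prop} (hp : SemiIn g p) :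
    ∃ c : ℕ, ∀ a, p a ↔ Halts g c (Encodable.encode a) := by
  obtain ⟨s, -, hs⟩ := exists_index₂ (hp.comp (Primrec.snd (α := ℕ) (β := α)).computableIn)
  exact ⟨s 0, hs 0⟩

end OracleCode

open OracleCode hiding encode

/-- The characteristic function of a set, as a total function; its coercion to a partial function
is `charFun X` by definition. -/
noncomputable def chi (X : Set ℕ) : ℕ → ℕ := X.indicator fun _ => 1

theorem chi_eq_one {X : Set ℕ} {n : ℕ} : chi X n = 1 ↔ n ∈ X := by
  by_cases h : n ∈ X <;> simp [chi, h]

theorem computableIn_chi_iff {g : ℕ → ℕ} {X : Set ℕ} :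
    ComputableIn (orc g) (chi X) ↔ DecIn g (· ∈ X) := by
  constructor
  · intro h
    exact ⟨fun n => decide (chi X n = 1),
      ComputableIn.comp (f := fun m => decide (m = 1))
        (Primrec.eq.comp Primrec.id (Primrec.const 1)).decide.computableIn h,
      fun n => by simp [chi_eq_one]⟩
  · rintro ⟨d, hd, h⟩
    refine (ComputableIn.comp (Primrec.dom_bool fun b => cond b 1 0).computableIn hd).of_eq
      fun n => ?_
    have := h n
    by_cases hn : n ∈ X <;> simp_all [chi]

theorem decIn_chi (X : Set ℕ) : DecIn (chi X) (· ∈ X) :=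
  computableIn_chi_iff.1 (computableIn_orc_self _)

theorem mem_turingJump {X : Set ℕ} {n : ℕ} : n ∈ turingJump X ↔ Halts (chi X) n n := Iff.rfl

/-- The jump of `X` is complete among the predicates semidecidable relative to `X`. -/
theorem SemiIn.exists_reduction {α : Type*} [Primcodable α] {X : Set ℕ} {p : α → Prop}
    (hp : SemiIn (chi X) p) : ∃ s : α → ℕ, Primrec s ∧ ∀ a, p a ↔ s a ∈ turingJump X := by
  obtain ⟨s, hs, h⟩ := exists_index₂ (hp.comp (Primrec.fst (α := α) (β := ℕ)).computableIn)
  exact ⟨s, hs, fun a => h a (s a)⟩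

theorem SemiIn.decIn_jump {α : Type*} [Primcodable α] {X : Set ℕ} {p : α → Prop}
    (hp : SemiIn (chi X) p) : DecIn (chi (turingJump X)) p := by
  obtain ⟨s, hs, h⟩ := hp.exists_reduction
  obtain ⟨d, hd, h'⟩ := (decIn_chi (turingJump X)).comp hs.computableIn
  exact ⟨d, hd, fun a => (h a).trans (h' a)⟩

/-- The halting problem, as a total oracle. -/
noncomputable def zeroJump : ℕ → ℕ := chi (turingJump ∅)

/-- `g` is low: every predicate semidecidable relative to `g` is decidable relative to the
halting problem. For characteristic functions this says that `X' ≤_T ∅'`. -/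
def Low (g : ℕ → ℕ) : Prop := ∀ p : ℕ → Prop, SemiIn g p → DecIn zeroJump p

namespace Low

theorem mono {g h : ℕ → ℕ} (hh : Low h) (hg : ComputableIn (orc h) g) : Low g :=
  fun p hp => hh p (hp.trans hg)

theorem decIn {g : ℕ → ℕ} (hg : Low g) {α : Type*} [Primcodable α] {p : α → Prop}
    (hp : SemiIn g p) : DecIn zeroJump p := by
  obtain ⟨c, hc⟩ := exists_index hp
  have h : SemiIn g fun n => Halts g c n :=
    (semiIn_halts g).comp (ComputableIn.pair (.const c) .id)
  obtain ⟨d, hd, h'⟩ := (hg _ h).comp (Primrec.encode (α := α)).computableIn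
  exact ⟨d, hd, fun a => (hc a).trans (h' a)⟩

theorem chi_empty : Low (chi ∅) := fun _ hp => hp.decIn_jump

theorem computableIn {g : ℕ → ℕ} (hg : Low g) : ComputableIn (orc zeroJump) g := by
  have hgraph : DecIn g fun p : ℕ × ℕ => g p.1 = p.2 :=
    (Primrec.eq (α := ℕ)).decIn.comp (f := fun p : ℕ × ℕ => (g p.1, p.2))
      (((computableIn_orc_self g).comp Primrec.fst.computableIn).pair Primrec.snd.computableIn)
  obtain ⟨d, hd, h⟩ := hg.decIn hgraph.semiIn
  refine RecursiveIn.of_eq_tot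
    (RecursiveIn.rfind (p := fun n m => Part.some (d (n, m))) hd) fun n => ?_
  refine Nat.mem_rfind.2 ⟨Part.mem_some_iff.2 ((h (n, g n)).1 rfl).symm, fun {m} hm => ?_⟩
  refine Part.mem_some_iff.2 ?_
  by_contra hne
  exact hm.ne ((h (n, m)).2 (by simpa using Ne.symm hne)).symm

end Low

/-- The join of two oracles. -/
def joinFn (f g : ℕ → ℕ) (n : ℕ) : ℕ := Nat.pair (f n) (g n)

theorem computableIn_joinFn_left (f g : ℕ → ℕ) : ComputableIn (orc (joinFn f g)) f :=
  ((Primrec.fst.comp Primrec.unpair).computableIn.comp (computableIn_orc_self _)).of_eq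
    fun n => by simp [joinFn]

theorem computableIn_joinFn_right (f g : ℕ → ℕ) : ComputableIn (orc (joinFn f g)) g :=
  ((Primrec.snd.comp Primrec.unpair).computableIn.comp (computableIn_orc_self _)).of_eq
    fun n => by simp [joinFn]

/-! ### The low basis theorem -/

/-- All binary strings of length `k`. -/
def strings : ℕ → List (List Bool)
  | 0 => [[]]
  | k + 1 => (strings k).flatMap fun τ => [τ ++ [false], τ ++ [true]]

theorem mem_strings {k : ℕ} {τ : List Bool} : τ ∈ strings k ↔ τ.length = k := by
  induction k generalizing τ with
  | zero => simp [strings, List.length_eq_zero_iff]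
  | succ k ih =>
    simp only [strings, List.mem_flatMap, List.mem_cons, List.not_mem_nil, or_false, ih]
    constructor
    · rintro ⟨σ, rfl, rfl | rfl⟩ <;> simp
    · intro h
      obtain ⟨σ, b, rfl⟩ : ∃ σ b, τ = σ ++ [b] :=
        ⟨τ.dropLast, τ.getLast (List.ne_nil_of_length_eq_add_one h),
          (List.dropLast_append_getLast _).symm⟩
      exact ⟨σ, by simpa using h, by cases b <;> simp⟩

theorem primrec_strings : Primrec strings := by
  have hsnoc : ∀ b : Bool, Primrec₂ fun (_ : ℕ × List (List Bool)) (τ : List Bool) => τ ++ [b] :=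
    fun b => Primrec.list_concat.comp Primrec.snd (Primrec.const b)
  have hpair : Primrec₂ fun (_ : ℕ × List (List Bool)) (τ : List Bool) =>
      [τ ++ [false], τ ++ [true]] :=
    Primrec.list_cons.comp (hsnoc false) (Primrec.list_cons.comp (hsnoc true) (Primrec.const []))
  refine (Primrec.nat_rec₁ (f := fun _ L => L.flatMap fun τ => [τ ++ [false], τ ++ [true]]) [[]]
    (Primrec.list_flatMap Primrec.snd hpair).to₂).of_eq fun n => ?_
  induction n with
  | zero => rfl
  | succ n ih => rw [strings, ← ih]

theorem pre_getD {α : Type*} (d : α) {τ : List α} {j : ℕ} (hj : j ≤ τ.length) :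
    pre (fun i => τ.getD i d) j = τ.take j :=
  List.ext_getElem (by simp [hj]) fun i h₁ h₂ => by
    have h₂ : i < τ.length := by simp at h₂; exact h₂.2
    simp [pre, h₂]

/-- Compactness of Cantor space, for a decreasing sequence of conditions on initial segments. -/
theorem exists_forall_pre {Q : ℕ → List Bool → Prop}
    (mono : ∀ {s t τ}, s ≤ t → Q t τ → Q s τ)
    (h : ∀ t, ∃ τ : List Bool, τ.length = t ∧ ∀ j ≤ t, Q t (τ.take j)) :
    ∃ Y : ℕ → Bool, ∀ t j, Q t (pre Y j) := by
  let C : ℕ → Set (ℕ → Bool) := fun t => ⋂ j ∈ Set.Iic t, {Y | Q t (pre Y j)}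
  have hC : ∀ t, IsClosed (C t) := fun t => isClosed_biInter fun j _ => by
    have : {Y : ℕ → Bool | Q t (pre Y j)} =
        (fun (Y : ℕ → Bool) (i : Fin j) => Y i) ⁻¹' {v | Q t (List.ofFn v)} := by
      ext Y
      simp only [Set.mem_ofPred_eq, Set.mem_preimage]
      rw [show pre Y j = List.ofFn fun i : Fin j => Y i from
        List.ext_getElem (by simp) (by simp [pre])]
    rw [this]
    exact (isClosed_discrete _).preimage (by fun_prop)
  obtain ⟨Y, hY⟩ := IsCompact.nonempty_iInter_of_sequence_nonempty_isCompact_isClosed C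
    (fun t Y hY => by
      simp only [C, Set.mem_iInter, Set.mem_Iic, Set.mem_ofPred_eq] at hY ⊢
      exact fun j hj => mono t.le_succ (hY j (hj.trans t.le_succ)))
    (fun t => by
      obtain ⟨τ, hτ, hQ⟩ := h t
      refine ⟨fun i => τ.getD i false, ?_⟩
      simp only [C, Set.mem_iInter, Set.mem_Iic, Set.mem_ofPred_eq]
      intro j hj
      rw [pre_getD _ (hj.trans hτ.ge)]
      exact hQ j hj)
    (hC 0).isCompact hC
  refine ⟨Y, fun t j => ?_⟩
  have := Set.mem_iInter.1 hY (max t j)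
  simp only [C, Set.mem_iInter, Set.mem_Iic, Set.mem_ofPred_eq] at this
  exact mono (le_max_left t j) (this j (le_max_right t j))

/-- The finite join of two lists. -/
def joinList (τ l : List ℕ) : List ℕ :=
  (List.range τ.length).map fun i => Nat.pair (τ.getD i 0) (l.getD i 0)

theorem primrec_joinList : Primrec₂ joinList := by
  refine Primrec.list_map (Primrec.list_range.comp (Primrec.list_length.comp Primrec.fst)) ?_
  exact Primrec₂.natPair.comp
    ((Primrec.list_getD 0).comp (Primrec.fst.comp Primrec.fst) Primrec.snd)
    ((Primrec.list_getD 0).comp (Primrec.snd.comp Primrec.fst) Primrec.snd)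

theorem joinList_pre (f g : ℕ → ℕ) {j k : ℕ} (h : j ≤ k) :
    joinList (pre f j) (pre g k) = pre (joinFn f g) j := by
  rw [joinList, length_pre]
  refine List.map_congr_left fun i hi => ?_
  have hi := List.mem_range.1 hi
  simp [List.getD_eq_getElem?_getD, pre, hi, hi.trans_le h, joinFn]

theorem primrecPred_run_isSome : PrimrecPred fun p : ℕ × List ℕ × ℕ =>
    (run p.1 p.2.1 p.2.2).isSome = true :=
  Primrec.primrecPred (by simpa using Primrec.option_isSome.comp primrec_run)

/-- A predicate semidecidable relative to a join `f ⊕ g` is a union of conditions on initial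
segments of `f`, monotone, and semidecidable relative to `g`. -/
theorem exists_semiIn_initial_segments {f g : ℕ → ℕ} {p : ℕ → Prop} (hp : SemiIn (joinFn f g) p) :
    ∃ q : ℕ × List ℕ → Prop, SemiIn g q ∧ (∀ n σ τ, σ <+: τ → q (n, σ) → q (n, τ)) ∧
      ∀ n, p n ↔ ∃ j, q (n, pre f j) := by
  obtain ⟨e, he⟩ := exists_index hp
  refine ⟨fun r => ∃ k, r.2.length ≤ (pre g k).length ∧
    (run e (joinList r.2 (pre g k)) r.1).isSome = true, ?_, ?_, fun n => ?_⟩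
  · refine SemiIn.of_pre (W := fun r : (ℕ × List ℕ) × List ℕ => r.1.2.length ≤ r.2.length ∧
      (run e (joinList r.1.2 r.2) r.1.1).isSome = true) ?_
    refine PrimrecPred.and ?_ ?_
    · exact Primrec.nat_le.comp (Primrec.list_length.comp (Primrec.snd.comp Primrec.fst))
        (Primrec.list_length.comp Primrec.snd)
    · exact primrecPred_run_isSome.comp (.pair (Primrec.const e)
        (.pair (primrec_joinList.comp (Primrec.snd.comp Primrec.fst) Primrec.snd)
          (Primrec.fst.comp Primrec.fst)))
  · rintro n σ τ hστ ⟨k, hk, hrun⟩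
    have hlen := hστ.length_le
    have hσ : σ = pre (fun i => τ.getD i 0) σ.length := by
      rw [pre_getD _ hlen]; exact List.prefix_iff_eq_take.1 hστ
    have hτ : τ = pre (fun i => τ.getD i 0) τ.length := by rw [pre_getD _ le_rfl, List.take_length]
    refine ⟨max k τ.length, by simp, ?_⟩
    dsimp only at hk hrun ⊢
    rw [length_pre] at hk
    rw [hσ, joinList_pre _ _ hk] at hrun
    rw [hτ, joinList_pre _ _ (by simp)]
    obtain ⟨m, hm⟩ := Option.isSome_iff_exists.1 hrun
    rw [run_mono (pre_prefix _ hlen) hm]; rfl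
  · rw [he, halts_iff_run]
    refine exists_congr fun j => ⟨fun h => ⟨j, by simp, ?_⟩, ?_⟩
    · rwa [joinList_pre f g le_rfl]
    · rintro ⟨k, hk, h⟩
      rwa [joinList_pre f g (by simpa using hk)] at h

/-- The program `c`, run with finite oracle `l`, halts on some initial segment of length at most
`|l|` of the string `τ`. -/
def HitsBy (l : List ℕ) (c : ℕ) (τ : List Bool) : Prop :=
  ∃ j < l.length + 1, (run c l (encode (τ.take j))).isSome = true

theorem primrecPred_hitsBy :
    PrimrecPred fun p : List ℕ × ℕ × List Bool => HitsBy p.1 p.2.1 p.2.2 := by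
  have h : PrimrecRel fun (j : ℕ) (p : List ℕ × ℕ × List Bool) =>
      (run p.2.1 p.1 (encode (p.2.2.take j))).isSome = true := by
    refine primrecPred_run_isSome.comp (f := fun q : ℕ × List ℕ × ℕ × List Bool =>
      (q.2.2.1, q.2.1, encode (q.2.2.2.take q.1))) ?_
    refine .pair (Primrec.fst.comp (Primrec.snd.comp Primrec.snd))
      (.pair (Primrec.fst.comp Primrec.snd) (Primrec.encode.comp ?_))
    exact Primrec.list_take.comp Primrec.fst (Primrec.snd.comp (Primrec.snd.comp Primrec.snd))
  refine (h.exists_mem_list.comp (f := fun p : List ℕ × ℕ × List Bool =>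
    List.range (p.1.length + 1)) (g := fun p => p) (Primrec.list_range.comp
      (Primrec.succ.comp (Primrec.list_length.comp Primrec.fst))) Primrec.id).of_eq fun p => ?_
  simp [HitsBy]

/-- The open sets coded by the programs in `D`, enumerated with finite oracle `l`, cover Cantor
space. -/
def CoversBy (D : List ℕ) (l : List ℕ) : Prop :=
  ∀ τ ∈ strings l.length, ∃ c ∈ D, HitsBy l c τ

theorem primrecPred_coversBy :
    PrimrecPred fun p : List ℕ × List ℕ => CoversBy p.1 p.2 := by
  have h₁ : PrimrecRel fun (c : ℕ) (q : List ℕ × List Bool) => HitsBy q.1 c q.2 :=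
    primrecPred_hitsBy.comp (f := fun r : ℕ × List ℕ × List Bool => (r.2.1, r.1, r.2.2))
      (.pair (Primrec.fst.comp Primrec.snd)
        (.pair Primrec.fst (Primrec.snd.comp Primrec.snd)))
  have h₂ : PrimrecRel fun (τ : List Bool) (p : List ℕ × List ℕ) =>
      ∃ c ∈ p.1, HitsBy p.2 c τ :=
    h₁.exists_mem_list.comp (f := fun q : List Bool × List ℕ × List ℕ => q.2.1)
      (g := fun q => (q.2.2, q.1)) (Primrec.fst.comp Primrec.snd)
      (.pair (Primrec.snd.comp Primrec.snd) Primrec.fst)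
  exact h₂.forall_mem_list.comp (primrec_strings.comp (Primrec.list_length.comp Primrec.snd))
    Primrec.id

/-- The low basis theorem, relative to a low oracle: a nonempty class of sequences avoiding a
semidecidable set of strings has a member whose join with the oracle is low. -/
theorem low_basis {X : ℕ → ℕ} (hX : Low X) {V : List Bool → Prop} (hV : SemiIn X V)
    (h : ∃ Z : ℕ → Bool, ∀ k, ¬V (pre Z k)) :
    ∃ Y : ℕ → Bool, (∀ k, ¬V (pre Y k)) ∧ Low (joinFn (fun n => (Y n).toNat) X) := by
  obtain ⟨c₀, hc₀⟩ := exists_index hV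
  obtain ⟨d, hd, hcov⟩ := hX.decIn (SemiIn.of_pre (g := X) primrecPred_coversBy)
  -- Greedily collect programs whose open sets can be avoided simultaneously.
  let D : ℕ → List ℕ := fun n =>
    Nat.rec (motive := fun _ => List ℕ) [c₀]
      (fun m L => cond (d (m :: L)) L (m :: L)) n
  have hDsucc : ∀ n, D (n + 1) = cond (d (n :: D n)) (D n) (n :: D n) := fun n => rfl
  have hD : ComputableIn (orc zeroJump) D := by
    have h₁ : ComputableIn (orc zeroJump) fun q : ℕ × ℕ × List ℕ => q.2.1 :: q.2.2 :=
      (Primrec.list_cons.comp (Primrec.fst.comp Primrec.snd)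
        (Primrec.snd.comp Primrec.snd)).computableIn
    have h₂ : ComputableIn (orc zeroJump) fun q : ℕ × ℕ × List ℕ =>
        (d (q.2.1 :: q.2.2), q.2.2, q.2.1 :: q.2.2) :=
      (hd.comp h₁).pair (.pair (Primrec.snd.comp Primrec.snd).computableIn h₁)
    have h₃ : ComputableIn (orc zeroJump) fun r : Bool × List ℕ × List ℕ =>
        cond r.1 r.2.1 r.2.2 :=
      (Primrec.cond Primrec.fst (Primrec.fst.comp Primrec.snd)
        (Primrec.snd.comp Primrec.snd)).computableIn
    have h₄ : ComputableIn₂ (orc zeroJump) fun (_ : ℕ) (q : ℕ × List ℕ) =>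
        cond (d (q.1 :: q.2)) q.2 (q.1 :: q.2) := by
      have := h₃.comp h₂
      exact this
    exact ComputableIn.nat_rec (f := fun n => n) (g := fun _ => [c₀]) .id (.const _) h₄
  have hDmono : ∀ {m n}, m ≤ n → ∀ c ∈ D m, c ∈ D n := by
    intro m n hmn
    induction n, hmn using Nat.le_induction with
    | base => exact fun _ => id
    | succ n _ ih =>
      intro c hc
      rw [hDsucc]
      cases d (n :: D n) <;> simp [ih c hc]
  have hDnot : ∀ n k, ¬CoversBy (D n) (pre X k) := by
    intro n
    induction n with
    | zero =>
      obtain ⟨Z, hZ⟩ := h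
      intro k hk
      obtain ⟨c, hc, j, hj, hrun⟩ := hk (pre Z k) (mem_strings.2 (by simp))
      obtain rfl : c = c₀ := by simpa [D] using hc
      rw [take_pre Z (by simpa using Nat.lt_succ_iff.1 hj)] at hrun
      exact hZ j ((hc₀ _).2 (halts_iff_run.2 ⟨k, hrun⟩))
    | succ n ih =>
      rw [hDsucc]
      cases e : d (n :: D n) with
      | true => exact ih
      | false =>
        intro k hk
        have := (hcov (n :: D n)).1 ⟨k, hk⟩
        simp_all
  obtain ⟨Y, hY⟩ := exists_forall_pre
    (Q := fun t τ => ∀ c ∈ D t, ¬(run c (pre X t) (encode τ)).isSome = true)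
    (fun {s t τ} hst hQ c hc hrun => hQ c (hDmono hst c hc) <| by
      obtain ⟨m, hm⟩ := Option.isSome_iff_exists.1 hrun
      rw [run_mono (pre_prefix X hst) hm]; rfl)
    (fun t => by
      have := hDnot t t
      simp only [CoversBy, HitsBy, not_forall, not_exists, not_and, length_pre] at this
      obtain ⟨τ, hτ, h⟩ := this
      exact ⟨τ, mem_strings.1 hτ, fun j hj c hc => h c hc j (Nat.lt_succ_iff.2 hj)⟩)
  have hmem : ∀ {c n}, c ∈ D n → ∀ j, ¬Halts X c (encode (pre Y j)) := by
    intro c n hc j hh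
    obtain ⟨k, hk⟩ := halts_iff_run.1 hh
    refine hY (max n k) j c (hDmono (le_max_left _ _) c hc) ?_
    obtain ⟨m, hm⟩ := Option.isSome_iff_exists.1 hk
    rw [run_mono (pre_prefix X (le_max_right _ _)) hm]; rfl
  have havoid : ∀ c, (∃ j, Halts X c (encode (pre Y j))) ↔ ¬ ∃ a ∈ D (c + 1), a = c := by
    intro c
    refine ⟨?_, fun hc => ?_⟩
    · rintro ⟨j, hj⟩ ⟨a, ha, rfl⟩
      exact hmem (n := a + 1) ha j hj
    have hdc : d (c :: D c) = true := by
      by_contra hne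
      exact hc ⟨c, by rw [hDsucc, Bool.eq_false_iff.2 hne]; simp, rfl⟩
    obtain ⟨k, hk⟩ := (hcov _).2 hdc
    obtain ⟨a, ha, j, hj, hrun⟩ := hk (pre Y k) (mem_strings.2 (by simp))
    rw [take_pre Y (by simpa using Nat.lt_succ_iff.1 hj)] at hrun
    rcases List.mem_cons.1 ha with rfl | ha
    · exact ⟨j, halts_iff_run.2 ⟨k, hrun⟩⟩
    · exact absurd (halts_iff_run.2 ⟨k, hrun⟩) (hmem ha j)
  refine ⟨Y, fun k hk => hmem (n := 0) (c := c₀) (by simp [D]) k ((hc₀ _).1 hk), fun p hp => ?_⟩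
  obtain ⟨q, hq, -, hpq⟩ := exists_semiIn_initial_segments hp
  have hq' : SemiIn X fun r : ℕ × List Bool => q (r.1, r.2.map Bool.toNat) :=
    hq.comp (Primrec.pair Primrec.fst (Primrec.list_map Primrec.snd
      ((Primrec.dom_bool Bool.toNat).comp Primrec.snd).to₂)).computableIn
  obtain ⟨s, hs, hqs⟩ := exists_index₂ hq'
  have hpre : ∀ j, pre (fun n => (Y n).toNat) j = (pre Y j).map Bool.toNat := fun j => by
    simp [pre, Function.comp_def]
  have hp' : ∀ n, p n ↔ ¬ ∃ a ∈ D (s n + 1), a = s n := fun n => by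
    rw [hpq, ← havoid]
    exact exists_congr fun j => by rw [hpre]; exact hqs n (pre Y j)
  have hmemp : PrimrecRel fun (L : List ℕ) (c : ℕ) => ¬ ∃ a ∈ L, a = c :=
    (PrimrecRel.exists_mem_list Primrec.eq).not
  have hres : DecIn zeroJump fun n => ¬ ∃ a ∈ D (s n + 1), a = s n :=
    (PrimrecPred.decIn hmemp).comp
      ((hD.comp (Primrec.succ.comp hs).computableIn).pair hs.computableIn)
  exact hres.imp fun _ h => ⟨h.1, fun n => (hp' n).trans (h.2 n)⟩

/-! ### Low oracles of PA degree -/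

/-- Seen with finite oracle `l`, no sequence through `σ` avoids the open set coded by `c`. -/
def DeadBy (c : ℕ) (l : List ℕ) (σ : List Bool) : Prop :=
  σ.length ≤ l.length ∧ ∀ τ ∈ strings l.length, τ.take σ.length ≠ σ ∨ HitsBy l c τ

theorem primrecPred_deadBy (c : ℕ) :
    PrimrecPred fun p : List ℕ × List Bool => DeadBy c p.1 p.2 := by
  have h : PrimrecRel fun (τ : List Bool) (p : List ℕ × List Bool) =>
      τ.take p.2.length ≠ p.2 ∨ HitsBy p.1 c τ := by
    refine PrimrecPred.or (PrimrecPred.not ?_) ?_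
    · exact Primrec.eq.comp (Primrec.list_take.comp (Primrec.list_length.comp
        (Primrec.snd.comp Primrec.snd)) Primrec.fst) (Primrec.snd.comp Primrec.snd)
    · exact primrecPred_hitsBy.comp (f := fun q : List Bool × List ℕ × List Bool =>
        (q.2.1, c, q.1)) (.pair (Primrec.fst.comp Primrec.snd) (.pair (.const c) Primrec.fst))
  refine PrimrecPred.and (Primrec.nat_le.comp (Primrec.list_length.comp Primrec.snd)
    (Primrec.list_length.comp Primrec.fst)) ?_
  exact h.forall_mem_list.comp (primrec_strings.comp (Primrec.list_length.comp Primrec.fst))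
    Primrec.id

theorem HitsBy.mono {X : ℕ → ℕ} {c k k' : ℕ} {τ : List Bool} (hk : k ≤ k')
    (h : HitsBy (pre X k) c (τ.take k)) : HitsBy (pre X k') c τ := by
  obtain ⟨j, hj, h⟩ := h
  rw [length_pre] at hj
  refine ⟨j, by rw [length_pre]; omega, ?_⟩
  rw [List.take_take, min_eq_left (by omega)] at h
  obtain ⟨m, hm⟩ := Option.isSome_iff_exists.1 h
  rw [run_mono (pre_prefix X hk) hm]; rfl

theorem DeadBy.mono {X : ℕ → ℕ} {c k k' : ℕ} {σ : List Bool} (hk : k ≤ k')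
    (h : DeadBy c (pre X k) σ) : DeadBy c (pre X k') σ := by
  have hσ : σ.length ≤ k := by simpa using h.1
  refine ⟨by simpa using hσ.trans hk, fun τ hτ => ?_⟩
  have hτ : τ.length = k' := by simpa using mem_strings.1 hτ
  refine (h.2 (τ.take k) (mem_strings.2 (by simp [hτ, hk]))).imp (fun h => ?_) (HitsBy.mono hk)
  rwa [List.take_take, min_eq_left hσ] at h

theorem DeadBy.of_children {c : ℕ} {l : List ℕ} {σ : List Bool}
    (h₀ : DeadBy c l (σ ++ [false])) (h₁ : DeadBy c l (σ ++ [true])) : DeadBy c l σ := by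
  have hlen : σ.length + 1 ≤ l.length := by simpa using h₀.1
  refine ⟨by omega, fun τ hτ => ?_⟩
  have hτ' := mem_strings.1 hτ
  by_contra hcon
  rw [not_or, not_not] at hcon
  have h : τ.take (σ.length + 1) = σ ++ [τ[σ.length]] := by
    rw [← List.take_concat_get' _ _ (by omega), hcon.1]
  cases e : τ[σ.length] with
  | false =>
    have := (h₀.2 τ hτ).resolve_right hcon.2
    simp [h, e] at this
  | true =>
    have := (h₁.2 τ hτ).resolve_right hcon.2
    simp [h, e] at this

/-- A diagonally nonrecursive two-valued sequence relative to `X` computes a member of every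
nonempty class of sequences avoiding a set of strings semidecidable relative to `X`. At each
string the sequence is asked which child to follow; the child seen to be dead first, if any, is
avoided. -/
theorem exists_avoiding_of_dnc {X : ℕ → ℕ} {Y : ℕ → Bool}
    (hY : ∀ e n, ∀ v ∈ eval X (ofNat e) n, v ≠ (Y (Nat.pair e n)).toNat)
    {V : List Bool → Prop} (hV : SemiIn X V) (h : ∃ Z : ℕ → Bool, ∀ k, ¬V (pre Z k)) :
    ∃ Z : ℕ → Bool, ComputableIn (orc fun n => (Y n).toNat) Z ∧ ∀ k, ¬V (pre Z k) := by
  classical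
  obtain ⟨c, hc⟩ := exists_index hV
  let F : List Bool → ℕ → Option ℕ := fun σ k =>
    if DeadBy c (pre X k) (σ ++ [false]) then some 0
    else if DeadBy c (pre X k) (σ ++ [true]) then some 1 else none
  have hF : ComputableIn₂ (orc X) F := by
    have hsnoc : ∀ b : Bool, PrimrecPred fun p : List ℕ × List Bool =>
        DeadBy c p.1 (p.2 ++ [b]) := fun b =>
      (primrecPred_deadBy c).comp (f := fun p : List ℕ × List Bool => (p.1, p.2 ++ [b]))
        (.pair Primrec.fst (Primrec.list_concat.comp Primrec.snd (Primrec.const b)))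
    have h₁ : ComputableIn (orc X) fun p : List ℕ × List Bool =>
        if DeadBy c p.1 (p.2 ++ [false]) then some 0
        else if DeadBy c p.1 (p.2 ++ [true]) then some 1 else (none : Option ℕ) :=
      (Primrec.ite (hsnoc false) (Primrec.const _)
        (Primrec.ite (hsnoc true) (Primrec.const _) (Primrec.const _))).computableIn
    have h₂ : ComputableIn (orc X) fun q : List Bool × ℕ => (pre X q.2, q.1) :=
      ((computableIn_pre (computableIn_orc_self X)).comp Primrec.snd.computableIn).pair
        Primrec.fst.computableIn
    have := h₁.comp h₂
    exact this
  obtain ⟨e, he⟩ := exists_eval_eq (RecursiveIn.iff_nat.2 (ComputableIn.rfindOpt (f := F) hF))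
  have hev : ∀ σ, eval X (ofNat e.encode) (Encodable.encode σ) = Nat.rfindOpt (F σ) := by
    intro σ
    rw [ofNat_encode, he]
    simp only [encodek, Part.coe_some, Part.bind_some]
    exact Part.map_id' (fun _ => rfl) _
  let b : List Bool → Bool := fun σ => Y (Nat.pair e.encode (Encodable.encode σ))
  have hb : ∀ σ, (∀ k, ¬DeadBy c (pre X k) σ) → ∀ k, ¬DeadBy c (pre X k) (σ ++ [b σ]) := by
    intro σ hσ k hk
    have hnot : ∀ k', ¬DeadBy c (pre X k') (σ ++ [!b σ]) := by
      intro k' hk'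
      have h₁ := hk.mono (le_max_left k k')
      have h₂ := hk'.mono (le_max_right k k')
      cases e : b σ <;> simp only [e, Bool.not_true, Bool.not_false] at h₁ h₂
      · exact hσ _ (h₁.of_children h₂)
      · exact hσ _ (h₂.of_children h₁)
    have hval : ∀ k' v, F σ k' = some v → v = (b σ).toNat := by
      intro k' v hv
      simp only [F] at hv
      cases e : b σ <;> simp only [e, Bool.not_true, Bool.not_false] at hnot
      · rw [if_neg (hnot k')] at hv
        split_ifs at hv
        simpa using hv.symm
      · split_ifs at hv with hd₁ hd₂
        · exact absurd hd₁ (hnot k')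
        · simpa using hv.symm
    have hdom : (Nat.rfindOpt (F σ)).Dom := by
      refine Nat.rfindOpt_dom.2 ⟨k, (b σ).toNat, ?_⟩
      simp only [F]
      cases e : b σ <;> simp only [e, Bool.not_true, Bool.not_false] at hnot hk
      · rw [if_pos hk]; rfl
      · rw [if_neg (hnot k), if_pos hk]; rfl
    obtain ⟨v, hv⟩ := Part.dom_iff_mem.1 hdom
    obtain ⟨k', hk'⟩ := Nat.rfindOpt_spec hv
    rw [← hev] at hv
    exact hY _ _ v hv (hval k' v hk')
  let S : ℕ → List Bool := fun n => Nat.rec [] (fun _ σ => σ ++ [b σ]) n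
  have hYc : ComputableIn (orc fun n => (Y n).toNat) Y :=
    (ComputableIn.comp (f := fun m => decide (m = 1))
      (Primrec.eq.comp Primrec.id (Primrec.const 1)).decide.computableIn
      (computableIn_orc_self fun n => (Y n).toNat)).of_eq fun n => by cases Y n <;> rfl
  have hbc : ComputableIn (orc fun n => (Y n).toNat) b :=
    hYc.comp (Primrec₂.natPair.comp (Primrec.const _) Primrec.encode).computableIn
  have hSc : ComputableIn (orc fun n => (Y n).toNat) S := by
    have h₁ : ComputableIn (orc fun n => (Y n).toNat) fun q : ℕ × ℕ × List Bool =>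
        (q.2.2, b q.2.2) :=
      (Primrec.snd.comp Primrec.snd).computableIn.pair
        (hbc.comp (Primrec.snd.comp Primrec.snd).computableIn)
    have h₂ : ComputableIn (orc fun n => (Y n).toNat) fun q : List Bool × Bool => q.1 ++ [q.2] :=
      (Primrec.list_concat.comp Primrec.fst Primrec.snd).computableIn
    have h₃ : ComputableIn₂ (orc fun n => (Y n).toNat) fun (_ : ℕ) (q : ℕ × List Bool) =>
        q.2 ++ [b q.2] := by
      have := h₂.comp h₁
      exact this
    exact ComputableIn.nat_rec (f := fun n => n) (g := fun _ => []) .id (.const _) h₃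
  have hpre : ∀ n, pre (fun n => b (S n)) n = S n := by
    intro n
    induction n with
    | zero => rfl
    | succ n ih => rw [pre_succ, ih]
  have hS : ∀ n k, ¬DeadBy c (pre X k) (S n) := by
    intro n
    induction n with
    | zero =>
      obtain ⟨Z, hZ⟩ := h
      intro k hk
      obtain ⟨j, hj, hrun⟩ := (hk.2 (pre Z k) (mem_strings.2 (by simp))).resolve_left (by simp [S])
      rw [take_pre Z (by simpa using Nat.lt_succ_iff.1 hj)] at hrun
      exact hZ j ((hc _).2 (halts_iff_run.2 ⟨k, hrun⟩))
    | succ n ih => exact hb _ ih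
  refine ⟨fun n => b (S n), hbc.comp hSc, fun j hj => ?_⟩
  obtain ⟨k, hk⟩ := halts_iff_run.1 ((hc _).1 hj)
  have hlen : (S j).length = j := by rw [← hpre, length_pre]
  refine hS j (max k j) ⟨by simp [hlen], fun τ hτ => ?_⟩
  by_contra hcon
  rw [not_or, not_not, hlen, ← hpre] at hcon
  refine hcon.2 ⟨j, by simp, ?_⟩
  rw [hcon.1]
  obtain ⟨m, hm⟩ := Option.isSome_iff_exists.1 hk
  rw [run_mono (pre_prefix X (le_max_left _ _)) hm]; rfl

/-- Above every low oracle `X` there is a low oracle computing a member of every nonempty class of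
sequences avoiding a set of strings semidecidable relative to `X`. -/
theorem exists_low_pa {X : ℕ → ℕ} (hX : Low X) :
    ∃ P : ℕ → ℕ, ComputableIn (orc P) X ∧ Low P ∧ ∀ V : List Bool → Prop, SemiIn X V →
      (∃ Z : ℕ → Bool, ∀ k, ¬V (pre Z k)) →
        ∃ Z : ℕ → Bool, ComputableIn (orc P) Z ∧ ∀ k, ¬V (pre Z k) := by
  classical
  -- The two-valued diagonally nonrecursive sequences are those avoiding the strings with a
  -- position `i` at which the value of the program `i.unpair.1` on input `i.unpair.2` appears.
  let W : ℕ → List Bool × List ℕ → Prop := fun i p =>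
    run i.unpair.1 p.2 i.unpair.2 = some (p.1.getD i false).toNat
  have hW : PrimrecRel W := by
    refine Primrec.eq.comp (primrec_run.comp (Primrec.pair
      (Primrec.fst.comp (Primrec.unpair.comp Primrec.fst))
      (Primrec.pair (Primrec.snd.comp Primrec.snd)
        (Primrec.snd.comp (Primrec.unpair.comp Primrec.fst))))) ?_
    exact Primrec.option_some.comp ((Primrec.dom_bool Bool.toNat).comp
      ((Primrec.list_getD false).comp (Primrec.fst.comp Primrec.snd) Primrec.fst))
  have hW' : PrimrecPred fun p : List Bool × List ℕ => ∃ i ∈ List.range p.1.length, W i p :=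
    hW.exists_mem_list.comp (Primrec.list_range.comp (Primrec.list_length.comp Primrec.fst))
      Primrec.id
  have hiff : ∀ Z : ℕ → Bool, (∀ j, ¬∃ k, ∃ i ∈ List.range (pre Z j).length,
      W i (pre Z j, pre X k)) ↔ ∀ e n, ∀ v ∈ eval X (ofNat e) n, v ≠ (Z (Nat.pair e n)).toNat := by
    intro Z
    constructor
    · rintro h e n v hv rfl
      obtain ⟨k, hk⟩ := mem_eval_iff_run.1 hv
      refine h (Nat.pair e n + 1) ⟨k, Nat.pair e n, by simp, ?_⟩
      have hZ : (pre Z (Nat.pair e n + 1)).getD (Nat.pair e n) false = Z (Nat.pair e n) := by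
        simp [pre]
      simp only [W, Nat.unpair_pair, hZ, hk]
    · rintro h j ⟨k, i, hi, hw⟩
      have hi : i < j := by simpa using hi
      refine h i.unpair.1 i.unpair.2 _ (mem_eval_iff_run.2 ⟨k, hw⟩) ?_
      simp [pre, hi]
  obtain ⟨Y, hY, hlow⟩ := low_basis hX (SemiIn.of_pre (g := X) hW')
    ⟨fun i => decide (1 ∉ eval X (ofNat i.unpair.1) i.unpair.2), (hiff _).2 fun e n v hv => by
      by_cases h : 1 ∈ eval X (ofNat e) n
      · simp [h, Part.mem_unique hv h]
      · rintro rfl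
        simp [h] at hv⟩
  refine ⟨_, computableIn_joinFn_right (fun n => (Y n).toNat) X, hlow, fun V hV hZ => ?_⟩
  obtain ⟨Z, hZ, hZV⟩ := exists_avoiding_of_dnc ((hiff Y).1 hY) hV hZ
  exact ⟨Z, hZ.trans_orc (computableIn_joinFn_left _ _), hZV⟩

/-! ### Low generic functions -/

/-- `D` is generic over `P`: every dense set of strings semidecidable relative to `P` contains
an initial segment of `D`. -/
def GenericOver (D P : ℕ → ℕ) : Prop :=
  ∀ V : List ℕ → Prop, SemiIn P V →
    (∀ σ, ∃ τ, σ <+: τ ∧ V τ) → ∃ k, V (pre D k)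

/-- A generic function is obtained by extending a finite string into each semidecidable set in turn
whenever that is possible. As `P` is low, the halting problem decides whether it is possible, and
this decision also settles the jump of the join. -/
theorem exists_low_generic {P : ℕ → ℕ} (hP : Low P) :
    ∃ D : ℕ → ℕ, Low (joinFn D P) ∧ GenericOver D P := by
  classical
  let ρ : ℕ → List ℕ := fun m => Denumerable.ofNat (List ℕ) m.unpair.1
  -- Search for an extension of a string in the set with a given index.
  let F : ℕ × List ℕ → ℕ → Option (List ℕ) := fun q m =>
    if (run q.1 (pre P m) (encode (q.2 ++ ρ m))).isSome = true then some (q.2 ++ ρ m) else none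
  have hρ : Primrec ρ := (Primrec.ofNat _).comp (Primrec.fst.comp Primrec.unpair)
  have hF : ComputableIn₂ (orc P) F := by
    have happ : Primrec fun r : (ℕ × List ℕ) × ℕ × List ℕ => r.1.2 ++ ρ r.2.1 :=
      Primrec.list_append.comp (Primrec.snd.comp Primrec.fst)
        (hρ.comp (Primrec.fst.comp Primrec.snd))
    have h₁ : ComputableIn (orc P) fun r : (ℕ × List ℕ) × ℕ × List ℕ =>
        if (run r.1.1 r.2.2 (encode (r.1.2 ++ ρ r.2.1))).isSome = true
          then some (r.1.2 ++ ρ r.2.1) else none :=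
      (Primrec.ite (primrecPred_run_isSome.comp (Primrec.pair (Primrec.fst.comp Primrec.fst)
        (Primrec.pair (Primrec.snd.comp Primrec.snd) (Primrec.encode.comp happ))))
        (Primrec.option_some.comp happ) (Primrec.const none)).computableIn
    have h₂ : ComputableIn (orc P) fun r : (ℕ × List ℕ) × ℕ => (r.1, r.2, pre P r.2) :=
      Primrec.fst.computableIn.pair (Primrec.snd.computableIn.pair
        ((computableIn_pre (computableIn_orc_self P)).comp Primrec.snd.computableIn))
    have := h₁.comp h₂
    exact this
  have hFsome : ∀ {q m τ}, F q m = some τ → q.2 <+: τ ∧ Halts P q.1 (encode τ) := by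
    intro q m τ h
    simp only [F] at h
    split_ifs at h with hrun
    obtain rfl := Option.some.inj h
    exact ⟨List.prefix_append _ _, halts_iff_run.2 ⟨m, hrun⟩⟩
  have hFdom : ∀ q, (Nat.rfindOpt (F q)).Dom ↔ ∃ τ, q.2 <+: τ ∧ Halts P q.1 (encode τ) := by
    intro q
    rw [Nat.rfindOpt_dom]
    refine ⟨fun ⟨m, τ, h⟩ => ⟨τ, hFsome h⟩, ?_⟩
    rintro ⟨_, ⟨σ, rfl⟩, h⟩
    obtain ⟨k, hk⟩ := halts_iff_run.1 h
    have hm : ρ (Nat.pair (encode σ) k) = σ := by simp [ρ]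
    refine ⟨Nat.pair (encode σ) k, q.2 ++ σ, ?_⟩
    obtain ⟨v, hv⟩ := Option.isSome_iff_exists.1 hk
    simp only [F, hm, run_mono (pre_prefix P (Nat.right_le_pair _ _)) hv]
    rfl
  obtain ⟨d, hd, hdom⟩ := hP.decIn (p := fun q : ℕ × List ℕ => (Nat.rfindOpt (F q)).Dom)
    ⟨fun q => (Nat.rfindOpt (F q)).map encode, (ComputableIn.rfindOpt (f := F) hF).map
      (Primrec.encode.comp Primrec.snd).computableIn, fun _ => Iff.rfl⟩
  let G : ℕ × List ℕ → ℕ → Option (List ℕ) := fun q m =>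
    cond (d q) ((F q m).map (· ++ [0])) (some (q.2 ++ [0]))
  have hG : ComputableIn₂ (orc zeroJump) G := by
    have h₁ : ComputableIn (orc zeroJump) fun r : Bool × Option (List ℕ) × List ℕ =>
        cond r.1 (r.2.1.map (· ++ [0])) (some (r.2.2 ++ [0])) :=
      (Primrec.cond Primrec.fst (Primrec.option_map (Primrec.fst.comp Primrec.snd)
        (Primrec.list_concat.comp Primrec.snd (Primrec.const 0)).to₂)
        (Primrec.option_some.comp (Primrec.list_concat.comp (Primrec.snd.comp Primrec.snd)
          (Primrec.const 0)))).computableIn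
    have h₂ : ComputableIn (orc zeroJump) fun r : (ℕ × List ℕ) × ℕ => (d r.1, F r.1 r.2, r.1.2) :=
      (hd.comp Primrec.fst.computableIn).pair ((ComputableIn.trans_orc hF hP.computableIn).pair
        (Primrec.snd.comp Primrec.fst).computableIn)
    have := h₁.comp h₂
    exact this
  have hnext : ∀ q, ∃ τ, τ ∈ Nat.rfindOpt (G q) := by
    intro q
    refine Part.dom_iff_mem.1 (Nat.rfindOpt_dom.2 ?_)
    cases e : d q with
    | false => exact ⟨0, q.2 ++ [0], by simp [G, e]⟩
    | true =>
      obtain ⟨m, τ, h⟩ := Nat.rfindOpt_dom.1 ((hdom q).2 e)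
      exact ⟨m, τ ++ [0], by simp only [G, e, cond_true]; rw [Option.mem_def.1 h]; rfl⟩
  choose next hnext using hnext
  have hnextc : ComputableIn (orc zeroJump) next :=
    RecursiveIn.of_eq_tot (ComputableIn.rfindOpt (f := G) hG) hnext
  have hnext₁ : ∀ q, (∃ τ, q.2 <+: τ ∧ Halts P q.1 (encode τ)) →
      ∃ τ, q.2 <+: τ ∧ Halts P q.1 (encode τ) ∧ next q = τ ++ [0] := by
    intro q hq
    obtain ⟨m, hm⟩ := Nat.rfindOpt_spec (hnext q)
    have hdq : d q = true := (hdom q).1 ((hFdom q).2 hq)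
    simp only [G, hdq, cond_true, Option.mem_def, Option.map_eq_some_iff] at hm
    obtain ⟨τ, hτ, heq⟩ := hm
    exact ⟨τ, (hFsome hτ).1, (hFsome hτ).2, heq.symm⟩
  have hnext₂ : ∀ q, ∃ τ, q.2 <+: τ ∧ next q = τ ++ [0] := by
    intro q
    by_cases hq : ∃ τ, q.2 <+: τ ∧ Halts P q.1 (encode τ)
    · obtain ⟨τ, h₁, -, h₂⟩ := hnext₁ q hq
      exact ⟨τ, h₁, h₂⟩
    · have hdq : d q = false := Bool.eq_false_iff.2 fun h => hq ((hFdom q).1 ((hdom q).2 h))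
      obtain ⟨m, hm⟩ := Nat.rfindOpt_spec (hnext q)
      simp only [G, hdq, cond_false, Option.mem_def] at hm
      exact ⟨q.2, List.prefix_rfl, (Option.some.inj hm).symm⟩
  let S : ℕ → List ℕ := fun n => Nat.rec [] (fun c σ => next (c, σ)) n
  have hSsucc : ∀ n, S (n + 1) = next (n, S n) := fun _ => rfl
  have hSc : ComputableIn (orc zeroJump) S := by
    have h₁ : ComputableIn₂ (orc zeroJump) fun (_ : ℕ) (q : ℕ × List ℕ) => next (q.1, q.2) := by
      have := hnextc.comp (g := fun r : ℕ × ℕ × List ℕ => r.2) Primrec.snd.computableIn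
      exact this
    exact ComputableIn.nat_rec (f := fun n => n) (g := fun _ => []) .id (.const _) h₁
  have hSmono : ∀ {m n}, m ≤ n → S m <+: S n := by
    intro m n hmn
    induction n, hmn using Nat.le_induction with
    | base => exact List.prefix_rfl
    | succ n _ ih =>
      obtain ⟨τ, h₁, h₂⟩ := hnext₂ (n, S n)
      rw [hSsucc, h₂]
      exact ih.trans (h₁.trans (List.prefix_append _ _))
  have hSlen : ∀ n, n ≤ (S n).length := by
    intro n
    induction n with
    | zero => exact Nat.zero_le _
    | succ n ih =>
      obtain ⟨τ, h₁, h₂⟩ := hnext₂ (n, S n)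
      have := h₁.length_le
      rw [hSsucc, h₂, List.length_append, List.length_singleton]
      dsimp only at this
      omega
  let D : ℕ → ℕ := fun n => (S (n + 1)).getD n 0
  have hD : ∀ n σ, σ <+: S n → σ = pre D σ.length := by
    intro n σ hσ
    have hS : ∀ i < σ.length, D i = (S n).getD i 0 := by
      intro i hi
      have hin := hi.trans_le hσ.length_le
      have hi' : i < (S (i + 1)).length := hSlen (i + 1)
      simp only [D, List.getD_eq_getElem?_getD]
      rcases le_total (i + 1) n with h | h
      · rw [(List.prefix_iff_getElem?.1 (hSmono h)) i hi', List.getElem?_eq_getElem hi']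
      · rw [(List.prefix_iff_getElem?.1 (hSmono h)) i hin, List.getElem?_eq_getElem hin]
    rw [pre_congr hS, pre_getD _ hσ.length_le]
    exact List.prefix_iff_eq_take.1 hσ
  have hmeet : ∀ c, (∃ τ, S c <+: τ ∧ Halts P c (encode τ)) →
      ∃ k, Halts P c (encode (pre D k)) := by
    intro c hc
    obtain ⟨τ, -, h₂, h₃⟩ := hnext₁ (c, S c) hc
    refine ⟨τ.length, ?_⟩
    rwa [← hD (c + 1) τ (by rw [hSsucc, h₃]; exact List.prefix_append _ _)]
  refine ⟨D, fun p hp => ?_, fun V hV hdense => ?_⟩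
  · obtain ⟨q, hq, hqmono, hpq⟩ := exists_semiIn_initial_segments hp
    obtain ⟨s, hs, hqs⟩ := exists_index₂ hq
    refine ⟨fun n => d (s n, S (s n)), hd.comp (hs.computableIn.pair (hSc.comp hs.computableIn)),
      fun n => ?_⟩
    refine Iff.trans ?_ ((hFdom _).symm.trans (hdom _))
    rw [hpq]
    constructor
    · rintro ⟨j, hj⟩
      have hpre := hD (s n) _ List.prefix_rfl
      refine ⟨pre D (max j (S (s n)).length), ?_, (hqs _ _).1 (hqmono _ _ _
        (pre_prefix D (le_max_left _ _)) hj)⟩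
      dsimp only
      nth_rewrite 1 [hpre]
      exact pre_prefix D (le_max_right _ _)
    · intro h
      obtain ⟨k, hk⟩ := hmeet (s n) h
      exact ⟨k, (hqs _ _).2 hk⟩
  · obtain ⟨c, hc⟩ := exists_index hV
    obtain ⟨τ, h₁, h₂⟩ := hdense (S c)
    obtain ⟨k, hk⟩ := hmeet c ⟨τ, h₁, (hc τ).1 h₂⟩
    exact ⟨k, (hc _).2 hk⟩

/-! ### The forcing step -/

/-- A generic function takes each value infinitely often on each infinite set computable from the
oracle. -/
theorem GenericOver.infinite_fiber {D P : ℕ → ℕ} (h : GenericOver D P) {X : Set ℕ}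
    (hX : X.Infinite) (hXP : ComputableIn (orc P) (chi X)) (m : ℕ) :
    (X ∩ {x | D x = m}).Infinite := by
  refine Set.infinite_of_forall_exists_gt fun n => ?_
  have hV : SemiIn P fun τ : List ℕ => ∃ x, (x < τ.length ∧ n < x ∧ τ.getD x 0 = m) ∧ x ∈ X := by
    refine DecIn.exists (p := fun q : List ℕ × ℕ =>
      (q.2 < q.1.length ∧ n < q.2 ∧ q.1.getD q.2 0 = m) ∧ q.2 ∈ X) (DecIn.and ?_ ?_)
    · exact PrimrecPred.decIn (PrimrecPred.and (Primrec.nat_lt.comp Primrec.snd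
        (Primrec.list_length.comp Primrec.fst)) (PrimrecPred.and
        (Primrec.nat_lt.comp (Primrec.const n) Primrec.snd)
        (Primrec.eq.comp ((Primrec.list_getD 0).comp Primrec.fst Primrec.snd) (Primrec.const m))))
    · exact (computableIn_chi_iff.1 hXP).comp Primrec.snd.computableIn
  obtain ⟨k, x, ⟨hxk, hnx, hxm⟩, hxX⟩ := h _ hV fun σ => by
    obtain ⟨x, hx, hxn⟩ := hX.exists_gt (max n σ.length)
    let y : ℕ → ℕ := fun i => if i < σ.length then σ.getD i 0 else m
    have hσ : σ = pre y σ.length := by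
      rw [pre_congr (h := fun i => σ.getD i 0) fun i hi => if_pos hi, pre_getD _ le_rfl,
        List.take_length]
    refine ⟨pre y (x + 1), ?_, x, ⟨by simp, by omega, ?_⟩, hx⟩
    · nth_rewrite 1 [hσ]
      exact pre_prefix y (by omega)
    · simp only [pre, List.getD_eq_getElem?_getD, List.getElem?_map,
        List.getElem?_range (Nat.lt_succ_self x), Option.map_some, Option.getD_some, y]
      exact if_neg (by omega)
  refine ⟨x, ⟨hxX, ?_⟩, hnx⟩
  have hxk : x < k := by simpa using hxk
  simpa [pre, hxk] using hxm

/-- `D` serves to code messages into subsets of the reservoir `X`: it is generic, and jointly low,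
over an oracle of PA degree above `X`. -/
def CodesFor (D : ℕ → ℕ) (X : Set ℕ) : Prop :=
  ∃ P : ℕ → ℕ, ComputableIn (orc P) (chi X) ∧ Low (joinFn D P) ∧ GenericOver D P ∧
    ∀ V : List Bool → Prop, SemiIn (chi X) V → (∃ Z : ℕ → Bool, ∀ k, ¬V (pre Z k)) →
      ∃ Z : ℕ → Bool, ComputableIn (orc P) Z ∧ ∀ k, ¬V (pre Z k)

theorem exists_codesFor {X : Set ℕ} (hX : Low (chi X)) : ∃ D, CodesFor D X := by
  obtain ⟨P, hXP, hP, hPA⟩ := exists_low_pa hX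
  obtain ⟨D, hD, hgen⟩ := exists_low_generic hP
  exact ⟨D, P, hXP, hD, hgen, hPA⟩

/-- The bits of `F ∪ E`, where `E` is the part of the set coded by `ρ` lying above `b`, in the
set coded by `l`, and on side `i` of the partition coded by `τ`. -/
def sideBits (F : Finset ℕ) (i : Bool) (b : ℕ) (ρ τ : List Bool) (l : List ℕ) : List ℕ :=
  (List.range τ.length).map fun x =>
    if x ∈ F ∨ b ≤ x ∧ ρ.getD x false = true ∧ l.getD x 0 = 1 ∧ τ.getD x false = i then 1 else 0

theorem Finset.primrecPred_mem (F : Finset ℕ) : PrimrecPred fun x => x ∈ F := by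
  refine ((PrimrecRel.exists_mem_list (R := fun a b : ℕ => a = b) Primrec.eq).comp
    (Primrec.const F.toList) Primrec.id).of_eq fun x => ?_
  simp

theorem primrec_sideBits (F : Finset ℕ) (i : Bool) :
    Primrec fun p : ℕ × List Bool × List Bool × List ℕ =>
      sideBits F i p.1 p.2.1 p.2.2.1 p.2.2.2 := by
  have hτ : Primrec fun p : ℕ × List Bool × List Bool × List ℕ => p.2.2.1 :=
    Primrec.fst.comp (Primrec.snd.comp Primrec.snd)
  refine Primrec.list_map (Primrec.list_range.comp (Primrec.list_length.comp hτ)) ?_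
  refine Primrec.ite (PrimrecPred.or (F.primrecPred_mem.comp Primrec.snd)
    (PrimrecPred.and ?_ (PrimrecPred.and ?_ (PrimrecPred.and ?_ ?_))))
    (Primrec.const 1) (Primrec.const 0)
  · exact Primrec.nat_le.comp (Primrec.fst.comp Primrec.fst) Primrec.snd
  · exact Primrec.eq.comp ((Primrec.list_getD false).comp
      (Primrec.fst.comp (Primrec.snd.comp Primrec.fst)) Primrec.snd) (Primrec.const true)
  · exact Primrec.eq.comp ((Primrec.list_getD 0).comp
      (Primrec.snd.comp (Primrec.snd.comp (Primrec.snd.comp Primrec.fst))) Primrec.snd)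
      (Primrec.const 1)
  · exact Primrec.eq.comp ((Primrec.list_getD false).comp (hτ.comp Primrec.fst) Primrec.snd)
      (Primrec.const i)

theorem sideBits_pre (F : Finset ℕ) (i : Bool) (b : ℕ) (r Z : ℕ → Bool) (X : Set ℕ) (j : ℕ) :
    sideBits F i b (pre r j) (pre Z j) (pre (chi X) j) =
      pre (chi (F ∪ {x | b ≤ x ∧ r x = true ∧ x ∈ X ∧ Z x = i})) j := by
  classical
  rw [sideBits, length_pre]
  refine List.map_congr_left fun x hx => ?_
  have hx := List.mem_range.1 hx
  simp only [pre, List.getD_eq_getElem?_getD, List.getElem?_map, List.getElem?_range hx,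
    Option.map_some, Option.getD_some, chi_eq_one]
  rw [chi, Set.indicator_apply]
  rfl

/-- Side `i` of the partition coded by `τ`, restricted to numbers at least `b` in the reservoir
coded by `l`, contains a set whose union with `F i` makes the program `e i` halt on its own
index, for one of the two sides `i`. -/
def SideHalts (F : Bool → Finset ℕ) (e : Bool → ℕ) (b : ℕ) (τ : List Bool) (l : List ℕ) : Prop :=
  ∃ ρ ∈ strings τ.length, (run (e false) (sideBits (F false) false b ρ τ l) (e false)).isSome ∨
    (run (e true) (sideBits (F true) true b ρ τ l) (e true)).isSome

theorem primrecPred_sideHalts (F : Bool → Finset ℕ) (e : Bool → ℕ) :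
    PrimrecPred fun p : ℕ × List Bool × List ℕ => SideHalts F e p.1 p.2.1 p.2.2 := by
  have h : ∀ i, PrimrecRel fun (ρ : List Bool) (p : ℕ × List Bool × List ℕ) =>
      (run (e i) (sideBits (F i) i p.1 ρ p.2.1 p.2.2) (e i)).isSome = true := fun i => by
    have hb : Primrec fun q : List Bool × ℕ × List Bool × List ℕ =>
        sideBits (F i) i q.2.1 q.1 q.2.2.1 q.2.2.2 :=
      (primrec_sideBits (F i) i).comp (.pair (Primrec.fst.comp Primrec.snd)
        (.pair Primrec.fst (Primrec.snd.comp Primrec.snd)))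
    exact primrecPred_run_isSome.comp (f := fun q : List Bool × ℕ × List Bool × List ℕ =>
      (e i, sideBits (F i) i q.2.1 q.1 q.2.2.1 q.2.2.2, e i))
      (.pair (.const _) (.pair hb (.const _)))
  have h' : PrimrecRel fun (ρ : List Bool) (p : ℕ × List Bool × List ℕ) =>
      (run (e false) (sideBits (F false) false p.1 ρ p.2.1 p.2.2) (e false)).isSome = true ∨
      (run (e true) (sideBits (F true) true p.1 ρ p.2.1 p.2.2) (e true)).isSome = true :=
    PrimrecPred.or (h false) (h true)
  exact h'.exists_mem_list.comp (primrec_strings.comp (Primrec.list_length.comp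
    (Primrec.fst.comp Primrec.snd))) Primrec.id

theorem sideHalts_pre {F : Bool → Finset ℕ} {e : Bool → ℕ} {b j : ℕ} {Z : ℕ → Bool} {X : Set ℕ} :
    SideHalts F e b (pre Z j) (pre (chi X) j) ↔
      ∃ i, ∃ E : Set ℕ, (∀ x ∈ E, b ≤ x ∧ x ∈ X ∧ Z x = i) ∧
        (run (e i) (pre (chi (F i ∪ E)) j) (e i)).isSome = true := by
  classical
  constructor
  · rintro ⟨ρ, hρ, h⟩
    have hρ : ρ = pre (fun i => ρ.getD i false) j := by
      have hlen : ρ.length = j := by simpa using mem_strings.1 hρ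
      rw [pre_getD _ hlen.ge, ← hlen, List.take_length]
    rw [hρ, sideBits_pre, sideBits_pre] at h
    rcases h with h | h
    · exact ⟨false, _, fun x hx => ⟨hx.1, hx.2.2⟩, h⟩
    · exact ⟨true, _, fun x hx => ⟨hx.1, hx.2.2⟩, h⟩
  · rintro ⟨i, E, hE, h⟩
    refine ⟨pre (fun x => decide (x ∈ E)) j, mem_strings.2 (by simp), ?_⟩
    have hEq : {x | b ≤ x ∧ decide (x ∈ E) = true ∧ x ∈ X ∧ Z x = i} = E := by
      ext x
      simp only [decide_eq_true_eq, Set.mem_ofPred_eq]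
      exact ⟨fun hx => hx.2.1, fun hx => ⟨(hE x hx).1, hx, (hE x hx).2⟩⟩
    rw [sideBits_pre, sideBits_pre]
    cases i
    · left; rwa [hEq]
    · right; rwa [hEq]

/-- Given a reservoir `X` and a function `D` coding messages into it, one of the programs `e i` can
be decided on its own index: for a suitable finite `E` on side `i`, all sets on side `i` that
extend `F i ∪ E` inside the smaller reservoir `X'` above `u` agree on whether it halts. The
elements of `E` have a constant colour that announces `u`. -/
theorem exists_forcing_step {X : Set ℕ} (hX : X.Infinite) {D : ℕ → ℕ} (hD : CodesFor D X)
    (col : ℕ → Bool) (F : Bool → Finset ℕ) (e : Bool → ℕ) (b : ℕ) :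
    ∃ (i : Bool) (E : Finset ℕ) (u : ℕ) (X' : Set ℕ) (v : Bool),
      X' ⊆ X ∧ X'.Infinite ∧ Low (chi X') ∧
      (∀ m, (X' ∩ {x | D x = m}).Infinite ∧ Low (chi (X' ∩ {x | D x = m}))) ∧
      (∀ x ∈ E, b ≤ x ∧ x < u ∧ x ∈ X ∧ col x = i ∧ D x = Nat.pair (u + 1) 0) ∧
      ∀ G : Set ℕ, ↑(F i) ∪ ↑E ⊆ G → (∀ x ∈ G, x ∈ F i ∨ x ∈ E ∨ (u ≤ x ∧ x ∈ X' ∧ col x = i)) →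
        (Halts (chi G) (e i) (e i) ↔ v = true) := by
  classical
  obtain ⟨P, hXP, hlow, hgen, hPA⟩ := hD
  have hDP : ComputableIn (orc (joinFn D P)) D := computableIn_joinFn_left D P
  have hPP : ComputableIn (orc (joinFn D P)) P := computableIn_joinFn_right D P
  have hlowP : ∀ Y : Set ℕ, ComputableIn (orc P) (chi Y) → Low (chi Y) := fun Y hY =>
    (hlow.mono hPP).mono hY
  have hfib : ∀ Y : Set ℕ, Y.Infinite → ComputableIn (orc P) (chi Y) → ∀ m,
      (Y ∩ {x | D x = m}).Infinite ∧ Low (chi (Y ∩ {x | D x = m})) := by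
    refine fun Y hY hYP m => ⟨hgen.infinite_fiber hY hYP m, hlow.mono ?_⟩
    refine computableIn_chi_iff.2 (DecIn.and (computableIn_chi_iff.1 (hYP.trans_orc hPP)) ?_)
    exact (PrimrecPred.decIn (Primrec.eq.comp Primrec.id (Primrec.const m))).comp hDP
  have hdec : DecIn (chi X) fun p : ℕ × List Bool =>
      SideHalts F e p.1 p.2 (pre (chi X) p.2.length) :=
    (primrecPred_sideHalts F e).decIn.comp (f := fun p : ℕ × List Bool =>
      (p.1, p.2, pre (chi X) p.2.length)) (Primrec.fst.computableIn.pair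
        (Primrec.snd.computableIn.pair ((computableIn_pre (computableIn_orc_self _)).comp
          (Primrec.list_length.comp Primrec.snd).computableIn)))
  by_cases hcase : ∃ b', b ≤ b' ∧ ∃ Z : ℕ → Bool, ∀ k, ¬SideHalts F e b' (pre Z k) (pre (chi X) k)
  · -- Some partition of the reservoir above `b'` makes both programs diverge on their sides.
    obtain ⟨b', hb', hZ⟩ := hcase
    obtain ⟨Z, hZP, hZ⟩ := hPA (fun τ => SideHalts F e b' τ (pre (chi X) τ.length))
      (hdec.comp (f := fun τ => (b', τ)) ((ComputableIn.const b').pair .id)).semiIn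
      (by simpa using hZ)
    simp only [length_pre] at hZ
    obtain ⟨i, hi⟩ : ∃ i, (X ∩ {x | Z x = i}).Infinite := by
      by_contra hcon
      simp only [not_exists, Set.not_infinite] at hcon
      refine hX (((hcon true).union (hcon false)).subset fun x hx => ?_)
      cases hz : Z x
      · exact Or.inr ⟨hx, hz⟩
      · exact Or.inl ⟨hx, hz⟩
    have hcomp : ComputableIn (orc P) (chi (X ∩ {x | Z x = i})) := by
      refine computableIn_chi_iff.2 (DecIn.and (computableIn_chi_iff.1 hXP) ?_)
      exact (PrimrecPred.decIn (Primrec.eq.comp Primrec.id (Primrec.const i))).comp hZP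
    refine ⟨i, ∅, b', _, false, Set.inter_subset_left, hi, hlowP _ hcomp, hfib _ hi hcomp,
      by simp, fun G hFG hG => ?_⟩
    simp only [Bool.false_eq_true, iff_false]
    intro hh
    obtain ⟨k, hk⟩ := halts_iff_run.1 hh
    refine hZ k (sideHalts_pre.2 ⟨i, G \ ↑(F i), ?_, ?_⟩)
    · rintro x ⟨hx, hxF⟩
      rcases hG x hx with h | h | h
      · exact absurd h hxF
      · simp at h
      · exact ⟨h.1, h.2.1.1, h.2.1.2⟩
    · rwa [Set.union_sdiff_cancel (Set.subset_union_left.trans hFG)]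
  · -- Otherwise compactness yields intervals on which every partition makes a program halt;
    -- by genericity `D` is constant on one of them, announcing its end.
    push Not at hcase
    have hcov : DecIn (chi X) fun q : ℕ × ℕ => ∀ τ ∈ strings q.2, ∃ j ∈ List.range (q.2 + 1),
        SideHalts F e (b + q.1) (τ.take j) ((pre (chi X) q.2).take j) := by
      have h₁ : PrimrecRel fun (j : ℕ) (p : List Bool × ℕ × List ℕ) =>
          SideHalts F e (b + p.2.1) (p.1.take j) (p.2.2.take j) :=
        (primrecPred_sideHalts F e).comp (f := fun r : ℕ × List Bool × ℕ × List ℕ =>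
          (b + r.2.2.1, r.2.1.take r.1, r.2.2.2.take r.1))
          (.pair (Primrec.nat_add.comp (.const b) (Primrec.fst.comp
            (Primrec.snd.comp Primrec.snd)))
            (.pair (Primrec.list_take.comp Primrec.fst (Primrec.fst.comp Primrec.snd))
              (Primrec.list_take.comp Primrec.fst (Primrec.snd.comp
                (Primrec.snd.comp Primrec.snd)))))
      have h₂ : PrimrecRel fun (τ : List Bool) (p : ℕ × List ℕ) =>
          ∃ j ∈ List.range (p.2.length + 1),
            SideHalts F e (b + p.1) (τ.take j) (p.2.take j) :=
        h₁.exists_mem_list.comp (f := fun q : List Bool × ℕ × List ℕ =>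
          List.range (q.2.2.length + 1)) (g := fun q => q)
          (Primrec.list_range.comp (Primrec.succ.comp (Primrec.list_length.comp
            (Primrec.snd.comp Primrec.snd)))) Primrec.id
      have h₃ : PrimrecPred fun p : ℕ × List ℕ => ∀ τ ∈ strings p.2.length,
          ∃ j ∈ List.range (p.2.length + 1),
            SideHalts F e (b + p.1) (τ.take j) (p.2.take j) :=
        h₂.forall_mem_list.comp (f := fun p : ℕ × List ℕ => strings p.2.length) (g := fun p => p)
          (primrec_strings.comp (Primrec.list_length.comp Primrec.snd)) Primrec.id
      have h₄ := h₃.decIn.comp (f := fun q : ℕ × ℕ => (q.1, pre (chi X) q.2))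
        (Primrec.fst.computableIn.pair ((computableIn_pre (computableIn_orc_self (chi X))).comp
          Primrec.snd.computableIn))
      simpa only [length_pre] using h₄
    have hcovex : ∀ a, ∃ t, ∀ τ ∈ strings t, ∃ j ∈ List.range (t + 1),
        SideHalts F e (b + a) (τ.take j) ((pre (chi X) t).take j) := by
      intro a
      by_contra hcon
      push Not at hcon
      obtain ⟨Z, hZ⟩ := exists_forall_pre
        (Q := fun _ τ => ¬SideHalts F e (b + a) τ (pre (chi X) τ.length)) (fun _ h => h)
        fun t => by
          obtain ⟨τ, hτ, h⟩ := hcon t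
          have hlen := mem_strings.1 hτ
          refine ⟨τ, hlen, fun j hj => ?_⟩
          have := h j (List.mem_range.2 (Nat.lt_succ_iff.2 hj))
          rw [take_pre _ hj] at this
          rwa [List.length_take, hlen, min_eq_left hj]
      obtain ⟨k, hk⟩ := hcase (b + a) (by omega) Z
      exact hZ 0 k (by simpa using hk)
    obtain ⟨d, hd, hcov⟩ := hcov
    obtain ⟨u, huc, hu⟩ : ∃ u : ℕ → ℕ, ComputableIn (orc (chi X)) u ∧ ∀ a, d (a, u a) = true := by
      have h₁ : ∀ a, ∃ t, t ∈ Nat.rfind fun t => Part.some (d (a, t)) := fun a => by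
        obtain ⟨t, ht⟩ := hcovex a
        obtain ⟨t', ht', -⟩ := Nat.rfind_min' (p := fun t => d (a, t)) ((hcov (a, t)).1 ht)
        exact ⟨t', ht'⟩
      choose u hu using h₁
      exact ⟨u, RecursiveIn.of_eq_tot (RecursiveIn.rfind
        (p := fun a t => Part.some (d (a, t))) hd) hu,
        fun a => (Part.mem_some_iff.1 (Nat.rfind_spec (hu a))).symm⟩
    have hV : SemiIn P fun τ : List ℕ => ∃ a, u a ≤ τ.length ∧ ∀ x ∈ List.range (u a),
        x < b + a ∨ τ.getD x 0 = Nat.pair (u a + 1) 0 := by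
      have h₁ : PrimrecRel fun (x : ℕ) (q : List ℕ × ℕ × ℕ) =>
          x < b + q.2.1 ∨ q.1.getD x 0 = Nat.pair (q.2.2 + 1) 0 := by
        refine PrimrecPred.or ?_ ?_
        · exact Primrec.nat_lt.comp Primrec.fst (Primrec.nat_add.comp (.const b)
            (Primrec.fst.comp (Primrec.snd.comp Primrec.snd)))
        · exact Primrec.eq.comp ((Primrec.list_getD 0).comp (Primrec.fst.comp Primrec.snd)
            Primrec.fst) (Primrec₂.natPair.comp (Primrec.succ.comp (Primrec.snd.comp
              (Primrec.snd.comp Primrec.snd))) (.const 0))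
      have h₂ : PrimrecPred fun q : List ℕ × ℕ × ℕ => q.2.2 ≤ q.1.length ∧
          ∀ x ∈ List.range q.2.2, x < b + q.2.1 ∨ q.1.getD x 0 = Nat.pair (q.2.2 + 1) 0 := by
        refine PrimrecPred.and (Primrec.nat_le.comp (Primrec.snd.comp Primrec.snd)
          (Primrec.list_length.comp Primrec.fst)) ?_
        exact h₁.forall_mem_list.comp (f := fun q : List ℕ × ℕ × ℕ => List.range q.2.2)
          (g := fun q => q) (Primrec.list_range.comp (Primrec.snd.comp Primrec.snd)) Primrec.id
      exact (h₂.decIn.comp (f := fun q : List ℕ × ℕ => (q.1, q.2, u q.2))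
        (Primrec.fst.computableIn.pair (Primrec.snd.computableIn.pair
          ((huc.trans_orc hXP).comp Primrec.snd.computableIn)))).exists
    obtain ⟨k, a, hak, hconst⟩ := hgen _ hV fun σ => by
      let y : ℕ → ℕ := fun i => if i < σ.length then σ.getD i 0
        else Nat.pair (u σ.length + 1) 0
      have hσ : σ = pre y σ.length := by
        rw [pre_congr (h := fun i => σ.getD i 0) fun i hi => if_pos hi, pre_getD _ le_rfl,
          List.take_length]
      refine ⟨pre y (max σ.length (u σ.length)), ?_, σ.length, by simp, fun x hx => ?_⟩
      · nth_rewrite 1 [hσ]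
        exact pre_prefix y (le_max_left _ _)
      · refine or_iff_not_imp_left.2 fun hxb => ?_
        have hx : x < max σ.length (u σ.length) :=
          (List.mem_range.1 hx).trans_le (le_max_right _ _)
        simp only [pre, List.getD_eq_getElem?_getD, List.getElem?_map, List.getElem?_range hx,
          Option.map_some, Option.getD_some, y]
        exact if_neg (by omega)
    rw [length_pre] at hak
    have hconst : ∀ x, b + a ≤ x → x < u a → D x = Nat.pair (u a + 1) 0 := by
      intro x hbx hxu
      have hxk := hxu.trans_le hak
      have := (hconst x (List.mem_range.2 hxu)).resolve_left (by omega)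
      simpa [pre, hxk] using this
    obtain ⟨j, hj, hside⟩ := (hcov (a, u a)).2 (hu a) (pre col (u a)) (mem_strings.2 (by simp))
    have hj : j ≤ u a := by simpa using Nat.lt_succ_iff.1 (List.mem_range.1 hj)
    rw [take_pre _ hj, take_pre _ hj] at hside
    obtain ⟨i, E, hE, hrun⟩ := sideHalts_pre.1 hside
    refine ⟨i, (Finset.range j).filter (· ∈ E), u a, X, true, subset_rfl, hX, hlowP _ hXP,
      hfib _ hX hXP, fun x hx => ?_, fun G hFG hG => ?_⟩
    · rw [Finset.mem_filter, Finset.mem_range] at hx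
      obtain ⟨h₁, h₂, h₃⟩ := hE x hx.2
      exact ⟨by omega, by omega, h₂, h₃, hconst x h₁ (by omega)⟩
    · simp only [iff_true]
      refine halts_iff_run.2 ⟨j, ?_⟩
      rw [pre_congr (h := chi (↑(F i) ∪ E)) fun x hx => ?_]
      · exact hrun
      have hiff : x ∈ G ↔ x ∈ ↑(F i) ∪ E := by
        constructor
        · intro hxG
          rcases hG x hxG with h | h | h
          · exact Or.inl h
          · exact Or.inr (Finset.mem_filter.1 h).2
          · omega
        · rintro (h | h)
          · exact hFG (Or.inl h)
          · exact hFG (Or.inr (by simp [hx, h]))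
      by_cases h : x ∈ G
      · simp only [chi, Set.indicator_of_mem h, Set.indicator_of_mem (hiff.1 h)]
      · simp only [chi, Set.indicator_of_notMem h, Set.indicator_of_notMem (mt hiff.2 h)]

/-! ### The construction -/

theorem CodesFor.exists_index {D : ℕ → ℕ} {X : Set ℕ} (h : CodesFor D X) :
    ∃ a, ∀ n, eval zeroJump (ofNat a) n = Part.some (D n) := by
  obtain ⟨P, -, hP, -⟩ := h
  have hD : ComputableIn (orc zeroJump) D :=
    (computableIn_joinFn_left D P).trans_orc hP.computableIn
  obtain ⟨e, he⟩ := exists_eval_eq (RecursiveIn.iff_nat.2 hD)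
  exact ⟨OracleCode.encode e, fun n => by simp [ofNat_encode, he]⟩

theorem Low.sdiff_Iio {X : Set ℕ} (hX : Low (chi X)) (b : ℕ) :
    Low (chi (X ∩ {x | b ≤ x})) := by
  refine hX.mono (computableIn_chi_iff.2 (DecIn.and (decIn_chi X) ?_))
  exact PrimrecPred.decIn (Primrec.nat_le.comp (Primrec.const b) Primrec.id)

/-- The message that the membership of `e` in the jump of side `i` is `v`. -/
def verdict (i : Bool) (e : ℕ) (v : Bool) : ℕ := Nat.pair i.toNat (Nat.pair e v.toNat)

/-- A forcing condition: `F j` is the finite part, below `b`, of side `j`, and all later elements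
are taken from the low reservoir `X`, into which the `zeroJump`-computable function `D` with index
`a` codes messages. -/
structure Condition (col : ℕ → Bool) where
  F : Bool → Finset ℕ
  b : ℕ
  X : Set ℕ
  D : ℕ → ℕ
  a : ℕ
  infinite : X.Infinite
  codesFor : CodesFor D X
  index : ∀ n, eval zeroJump (ofNat a) n = Part.some (D n)
  lt_bound : ∀ j, ∀ x ∈ F j, x < b
  col_eq : ∀ j, ∀ x ∈ F j, col x = j

namespace Condition

variable {col : ℕ → Bool}

theorem exists_initial : ∃ p : Condition col, p.b = 0 := by
  have hlow : Low (chi Set.univ) := Low.chi_empty.mono (computableIn_chi_iff.2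
    ⟨fun _ => true, .const true, by simp⟩)
  obtain ⟨D, hD⟩ := exists_codesFor hlow
  obtain ⟨a, ha⟩ := hD.exists_index
  exact ⟨⟨fun _ => ∅, 0, _, D, a, Set.infinite_univ, hD, ha, by simp, by simp⟩, rfl⟩

/-- The possible elements of side `j` under the condition `p`. -/
def Admits (p : Condition col) (j : Bool) (G : Set ℕ) : Prop :=
  ↑(p.F j) ⊆ G ∧ ∀ x ∈ G, x ∈ p.F j ∨ (p.b ≤ x ∧ x ∈ p.X ∧ col x = j)

/-- `q` extends `p` by deciding the program `e i`, with verdict `v`. On side `i` a finite set `E`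
may be added, all of whose elements announce the number `u`. To each side `j` is then added a
number `x j ≥ u` coding the index of the next coding function and the verdict. -/
structure Step (p q : Condition col) (e : Bool → ℕ) (i v : Bool) (E : Finset ℕ) (u : ℕ)
    (x : Bool → ℕ) : Prop where
  reservoir : q.X ⊆ p.X
  bound : p.b ≤ q.b
  mem_F : ∀ j y, y ∈ q.F j ↔ y ∈ p.F j ∨ (j = i ∧ y ∈ E) ∨ y = x j
  mem_E : ∀ y ∈ E, p.b ≤ y ∧ y < u ∧ y ∈ p.X ∧ col y = i ∧ p.D y = Nat.pair (u + 1) 0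
  mem_x : ∀ j, p.b ≤ x j ∧ u ≤ x j ∧ x j < q.b ∧ x j ∈ p.X ∧ col (x j) = j ∧
    p.D (x j) = Nat.pair 0 (Nat.pair q.a (verdict i (e i) v))
  decides : ∀ G, q.Admits i G → (Halts (chi G) (e i) (e i) ↔ v = true)

theorem exists_step (hcol : ∀ Y : Set ℕ, Y.Infinite → Low (chi Y) → ∀ j, ∃ x ∈ Y, col x = j)
    (p : Condition col) (e : Bool → ℕ) : ∃ q i v E u x, Step p q e i v E u x := by
  classical
  obtain ⟨i, E, u, X', v, hX'X, hX', hlow, hmsg, hE, hdec⟩ :=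
    exists_forcing_step p.infinite p.codesFor col p.F e p.b
  obtain ⟨D', hD'⟩ := exists_codesFor hlow
  obtain ⟨a', ha'⟩ := hD'.exists_index
  have hx : ∀ j, ∃ x, (x ∈ X' ∧ p.D x = Nat.pair 0 (Nat.pair a' (verdict i (e i) v))) ∧
      max p.b u ≤ x ∧ col x = j := fun j => by
    obtain ⟨hinf, hlow⟩ := hmsg (Nat.pair 0 (Nat.pair a' (verdict i (e i) v)))
    obtain ⟨x, ⟨hx, hbx⟩, hxj⟩ := hcol _ (Set.infinite_of_forall_exists_gt fun n => by
      obtain ⟨x, hx, hn⟩ := hinf.exists_gt (max n (max p.b u))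
      exact ⟨x, ⟨hx, ((le_max_right _ _).trans_lt hn).le⟩, (le_max_left _ _).trans_lt hn⟩)
      (hlow.sdiff_Iio (max p.b u)) j
    exact ⟨x, hx, hbx, hxj⟩
  choose x hx hbx hxj using hx
  have hbx : ∀ j, p.b ≤ x j ∧ u ≤ x j := fun j => max_le_iff.1 (hbx j)
  have hmem : ∀ j y, y ∈ p.F j ∪ (if j = i then E else ∅) ∪ {x j} ↔
      y ∈ p.F j ∨ (j = i ∧ y ∈ E) ∨ y = x j := fun j y => by
    by_cases h : j = i <;> simp only [h, if_true, if_false, Finset.mem_union,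
      Finset.mem_singleton, Finset.notMem_empty] <;> tauto
  have hb : ∀ j, x j < max (x false) (x true) + 1 := fun j => by cases j <;> omega
  refine ⟨⟨fun j => p.F j ∪ (if j = i then E else ∅) ∪ {x j}, max (x false) (x true) + 1, X', D',
    a', hX', hD', ha', fun j y hy => ?_, fun j y hy => ?_⟩, i, v, E, u, x, hX'X, ?_, hmem, hE,
    fun j => ⟨(hbx j).1, (hbx j).2, hb j, hX'X (hx j).1, hxj j, (hx j).2⟩, fun G hG => ?_⟩
  · have := hb j
    have := hbx j
    rcases (hmem j y).1 hy with h | ⟨-, h⟩ | rfl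
    · have := p.lt_bound j y h
      omega
    · have := hE y h
      omega
    · omega
  · rcases (hmem j y).1 hy with h | ⟨rfl, h⟩ | rfl
    · exact p.col_eq j y h
    · exact (hE y h).2.2.2.1
    · exact hxj j
  · have := hb i
    have := hbx i
    change _ ≤ max (x false) (x true) + 1
    omega
  · refine hdec G (fun y hy => hG.1 ((hmem i y).2 ?_)) fun y hy => ?_
    · exact hy.imp id fun h => Or.inl ⟨rfl, h⟩
    · rcases hG.2 y hy with h | ⟨h₁, h₂, h₃⟩
      · rcases (hmem i y).1 h with h | ⟨-, h⟩ | rfl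
        · exact Or.inl h
        · exact Or.inr (Or.inl h)
        · exact Or.inr (Or.inr ⟨(hbx i).2, (hx i).1, hxj i⟩)
      · have : max (x false) (x true) + 1 ≤ y := h₁
        have := hb i
        have := hbx i
        exact Or.inr (Or.inr ⟨by omega, h₂, h₃⟩)

/-- What a condition admits after a step, it admitted before. -/
theorem Step.admits {p q : Condition col} {e : Bool → ℕ} {i v : Bool} {E : Finset ℕ} {u : ℕ}
    {x : Bool → ℕ} (h : Step p q e i v E u x) {j : Bool} {G : Set ℕ} (hG : q.Admits j G) :
    p.Admits j G := by
  refine ⟨fun y hy => hG.1 ((h.mem_F j y).2 (Or.inl hy)), fun y hy => ?_⟩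
  rcases hG.2 y hy with hy | ⟨h₁, h₂, h₃⟩
  · rcases (h.mem_F j y).1 hy with hy | ⟨rfl, hy⟩ | rfl
    · exact Or.inl hy
    · have := h.mem_E y hy
      exact Or.inr ⟨this.1, this.2.2.1, this.2.2.2.1⟩
    · have := h.mem_x j
      exact Or.inr ⟨this.1, this.2.2.2.1, this.2.2.2.2.1⟩
  · exact Or.inr ⟨h.bound.trans h₁, h.reservoir h₂, h₃⟩

end Condition

/-! ### Decoding -/

/-- The state of the decoder: the index `a` of the current coding function, the position `β` from
which the set is still to be read, and the last verdict `w` read. -/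
abbrev DecoderState := ℕ × ℕ × ℕ

/-- The state of the decoder after reading the message `d` at the number `y`. The message is
either a number `u + 1`, in which case reading is resumed at `u`, or a pair `(0, m)`, in which case
`m` consists of the next index and a verdict. -/
def DecoderState.next (S : DecoderState) (y d : ℕ) : DecoderState :=
  if d.unpair.1 = 0 then (d.unpair.2.unpair.1, y + 1, d.unpair.2.unpair.2)
  else (S.1, d.unpair.1 - 1, S.2.2)

theorem DecoderState.primrec_next :
    Primrec fun r : (DecoderState × ℕ) × ℕ => DecoderState.next r.1.1 r.1.2 r.2 := by
  have hd : Primrec fun r : (DecoderState × ℕ) × ℕ => r.2.unpair :=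
    Primrec.unpair.comp Primrec.snd
  have hm : Primrec fun r : (DecoderState × ℕ) × ℕ => r.2.unpair.2.unpair :=
    Primrec.unpair.comp (Primrec.snd.comp hd)
  refine Primrec.ite (Primrec.eq.comp (Primrec.fst.comp hd) (Primrec.const 0)) ?_ ?_
  · exact (Primrec.fst.comp hm).pair ((Primrec.succ.comp (Primrec.snd.comp Primrec.fst)).pair
      (Primrec.snd.comp hm))
  · exact (Primrec.fst.comp (Primrec.fst.comp Primrec.fst)).pair
      ((Primrec.nat_sub.comp (Primrec.fst.comp hd) (Primrec.const 1)).pair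
        (Primrec.snd.comp (Primrec.snd.comp (Primrec.fst.comp Primrec.fst))))

/-- The least element of `G` that is at least `β`. -/
noncomputable def leastAbove (G : Set ℕ) (β : ℕ) : Part ℕ :=
  open Classical in Nat.rfind fun y => Part.some (decide (y ∈ G ∧ β ≤ y))

theorem recursiveIn_leastAbove {O : ℕ → ℕ} {G : Set ℕ} (hG : ComputableIn (orc O) (chi G)) :
    RecursiveIn (orc O) (leastAbove G) := by
  classical
  obtain ⟨d, hd, h⟩ : DecIn O fun q : ℕ × ℕ => q.2 ∈ G ∧ q.1 ≤ q.2 :=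
    DecIn.and ((computableIn_chi_iff.1 hG).comp Primrec.snd.computableIn)
      (PrimrecPred.decIn Primrec.nat_le)
  have h₁ : ComputableIn₂ (orc O) fun β y : ℕ => decide (y ∈ G ∧ β ≤ y) :=
    hd.of_eq fun q => by rw [Bool.eq_iff_iff, ← h q, decide_eq_true_iff]
  exact RecursiveIn.rfind (p := fun β y => Part.some (decide (y ∈ G ∧ β ≤ y))) h₁

theorem mem_leastAbove {G : Set ℕ} {β y : ℕ} (hy : y ∈ G) (hβ : β ≤ y)
    (hmin : ∀ z ∈ G, β ≤ z → y ≤ z) : y ∈ leastAbove G β := by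
  refine Nat.mem_rfind.2 ⟨by simp [hy, hβ], fun {z} hz => ?_⟩
  have : ¬(z ∈ G ∧ β ≤ z) := fun h => (hmin z h.1 h.2).not_gt hz
  simp [this]

/-- One step of the decoder reading `G`. -/
noncomputable def decodeStep (G : Set ℕ) (S : DecoderState) : Part DecoderState :=
  (leastAbove G S.2.1).bind fun y => (eval zeroJump (ofNat S.1) y).map (S.next y)

theorem recursiveIn_decodeStep {O : ℕ → ℕ} {G : Set ℕ} (hG : ComputableIn (orc O) (chi G))
    (hO : ComputableIn (orc O) zeroJump) : RecursiveIn (orc O) (decodeStep G) := by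
  have h₁ := RecursiveIn.comp (g := fun S : DecoderState => S.2.1) (recursiveIn_leastAbove hG)
    (Primrec.fst.comp Primrec.snd).computableIn
  have h₂ : RecursiveIn (orc O) fun p : ℕ × ℕ => eval zeroJump (ofNat p.1) p.2 :=
    RecursiveIn.trans_orc (recursiveIn_eval zeroJump) hO
  have h₃ := RecursiveIn.comp (g := fun q : DecoderState × ℕ => (q.1.1, q.2)) h₂
    ((Primrec.fst.comp Primrec.fst).pair Primrec.snd).computableIn
  have h₄ := RecursiveIn.map (g := fun (q : DecoderState × ℕ) d => q.1.next q.2 d) h₃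
    DecoderState.primrec_next.computableIn
  exact RecursiveIn.bind (f := fun S : DecoderState => leastAbove G S.2.1)
    (g := fun S y => (eval zeroJump (ofNat S.1) y).map (S.next y)) h₁ h₄

theorem mem_decodeStep {G : Set ℕ} {S : DecoderState} {D : ℕ → ℕ}
    (hD : ∀ n, eval zeroJump (ofNat S.1) n = Part.some (D n)) {y : ℕ} (hy : y ∈ G)
    (hSy : S.2.1 ≤ y) (hmin : ∀ z ∈ G, S.2.1 ≤ z → y ≤ z) :
    S.next y (D y) ∈ decodeStep G S := by
  refine Part.mem_bind_iff.2 ⟨y, mem_leastAbove hy hSy hmin, ?_⟩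
  rw [hD, Part.map_some]
  exact Part.mem_some _

/-- The decoder needs one or two steps to pass from a condition to its extension: it is sent past
`E` by the least element of `E`, and then reads the message at `x j`. -/
theorem Condition.Step.exists_decodeStep {col : ℕ → Bool} {p q : Condition col} {e : Bool → ℕ}
    {i v : Bool} {E : Finset ℕ} {u : ℕ} {x : Bool → ℕ} (h : Step p q e i v E u x) {j : Bool}
    {G : Set ℕ} (hG : q.Admits j G) {β w : ℕ} (hβ : β ≤ p.b) (hgap : ∀ y ∈ G, β ≤ y → p.b ≤ y) :
    ∃ β' ≤ q.b, (∀ y ∈ G, β' ≤ y → q.b ≤ y) ∧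
      ((q.a, β', verdict i (e i) v) ∈ decodeStep G (p.a, β, w) ∨
        ∃ S, S ∈ decodeStep G (p.a, β, w) ∧ S.2.2 = w ∧
          (q.a, β', verdict i (e i) v) ∈ decodeStep G S) := by
  classical
  obtain ⟨hbx, hux, hxb, -, -, hDx⟩ := h.mem_x j
  have hG' : ∀ y ∈ G, p.b ≤ y → y < q.b → (j = i ∧ y ∈ E) ∨ y = x j := fun y hy h₁ h₂ => by
    rcases hG.2 y hy with h₃ | h₃
    · refine ((h.mem_F j y).1 h₃).resolve_left fun h₄ => ?_
      have := p.lt_bound j y h₄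
      omega
    · omega
  have hxG : x j ∈ G := hG.1 ((h.mem_F j _).2 (Or.inr (Or.inr rfl)))
  have hend : ∀ y ∈ G, x j + 1 ≤ y → q.b ≤ y := fun y hy hxy => by
    by_contra hlt
    rcases hG' y hy (by omega) (by omega) with ⟨-, h₁⟩ | h₁
    · have := h.mem_E y h₁
      omega
    · omega
  have key : ∀ γ w', γ ≤ x j → (∀ y ∈ G, γ ≤ y → x j ≤ y) →
      (q.a, x j + 1, verdict i (e i) v) ∈ decodeStep G (p.a, γ, w') := fun γ w' h₁ h₂ => by
    have := mem_decodeStep (S := (p.a, γ, w')) p.index hxG h₁ h₂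
    rw [hDx] at this
    simpa [DecoderState.next] using this
  refine ⟨x j + 1, hxb, hend, ?_⟩
  by_cases hE : j = i ∧ E.Nonempty
  · obtain ⟨rfl, hE⟩ := hE
    right
    have hy := Finset.min'_mem E hE
    obtain ⟨hby, hyu, -, -, hDy⟩ := h.mem_E _ hy
    have hmin : ∀ z ∈ G, β ≤ z → E.min' hE ≤ z := fun z hz hβz => by
      by_cases hzb : z < q.b
      · rcases hG' z hz (hgap z hz hβz) hzb with ⟨-, h₁⟩ | h₁
        · exact Finset.min'_le E z h₁
        · omega
      · omega
    have := mem_decodeStep (S := (p.a, β, w)) p.index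
      (hG.1 ((h.mem_F j _).2 (Or.inr (Or.inl ⟨rfl, hy⟩)))) (hβ.trans hby) hmin
    rw [hDy] at this
    refine ⟨(p.a, u, w), by simpa [DecoderState.next] using this, rfl, key u w hux fun z hz huz => ?_⟩
    by_cases hzb : p.b ≤ z ∧ z < q.b
    · rcases hG' z hz hzb.1 hzb.2 with ⟨-, h₁⟩ | h₁
      · have := h.mem_E z h₁
        omega
      · omega
    · have := hgap z hz (by omega)
      omega
  · left
    refine key β w (hβ.trans hbx) fun z hz hβz => ?_
    by_cases hzb : z < q.b
    · rcases hG' z hz (hgap z hz hβz) hzb with ⟨h₁, h₂⟩ | h₁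
      · exact absurd ⟨h₁, z, h₂⟩ hE
      · omega
    · omega

/-- A computable sequence of triples `(t, n, v)` such that all triples with first component `t₀`
are correct about `p n`, and all `n` occur, decides `p`. -/
theorem decIn_of_verdicts {O : ℕ → ℕ} {p : ℕ → Prop} {t₀ : ℕ} {w : ℕ → ℕ}
    (hw : ComputableIn (orc O) w)
    (hcorrect : ∀ k n v, w k = Nat.pair t₀ (Nat.pair n v) → (p n ↔ v = 1))
    (hall : ∀ n, ∃ k v, w k = Nat.pair t₀ (Nat.pair n v)) : DecIn O p := by
  let M : ℕ × ℕ → Bool := fun q =>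
    decide (q.2.unpair.1 = t₀ ∧ q.2.unpair.2.unpair.1 = q.1)
  have hM : Primrec M := PrimrecPred.decide (PrimrecPred.and
    (Primrec.eq.comp (Primrec.fst.comp (Primrec.unpair.comp Primrec.snd)) (.const t₀))
    (Primrec.eq.comp (Primrec.fst.comp (Primrec.unpair.comp (Primrec.snd.comp
      (Primrec.unpair.comp Primrec.snd)))) Primrec.fst))
  have hMw : ∀ n k, M (n, w k) = true ↔ ∃ v, w k = Nat.pair t₀ (Nat.pair n v) := fun n k => by
    simp only [M, decide_eq_true_eq]
    constructor
    · rintro ⟨h₁, h₂⟩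
      exact ⟨(w k).unpair.2.unpair.2, by rw [← h₁, ← h₂, Nat.pair_unpair, Nat.pair_unpair]⟩
    · rintro ⟨v, hv⟩
      simp [hv]
  have h₁ : ComputableIn (orc O) fun q : ℕ × ℕ => M (q.1, w q.2) := by
    have h := hM.computableIn.comp (O := orc O) (g := fun q : ℕ × ℕ => (q.1, w q.2))
      (Primrec.fst.computableIn.pair (hw.comp Primrec.snd.computableIn))
    exact h
  have h₂ : ∀ n, ∃ k, k ∈ Nat.rfind fun k => Part.some (M (n, w k)) := fun n => by
    obtain ⟨k, hk⟩ := hall n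
    obtain ⟨k', hk', -⟩ := Nat.rfind_min' (p := fun k => M (n, w k)) ((hMw n k).2 hk)
    exact ⟨k', hk'⟩
  choose κ hκ using h₂
  have h₃ : ComputableIn (orc O) κ := RecursiveIn.of_eq_tot
    (RecursiveIn.rfind (p := fun n k => Part.some (M (n, w k))) h₁) hκ
  have h₄ : Primrec fun m : ℕ => decide (m.unpair.2.unpair.2 = 1) :=
    PrimrecPred.decide (Primrec.eq.comp (Primrec.snd.comp (Primrec.unpair.comp (Primrec.snd.comp
      Primrec.unpair))) (.const 1))
  have h₅ := h₄.computableIn.comp (hw.comp h₃)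
  refine ⟨_, h₅, fun n => ?_⟩
  obtain ⟨v, hv⟩ := (hMw n (κ n)).1 (Part.mem_some_iff.1 (Nat.rfind_spec (hκ n))).symm
  rw [hcorrect _ _ _ hv, hv]
  simp

/-- If the programs on side `j` are all decided during a run of the construction, the
resulting side `j` decides its own jump with the help of the halting problem. -/
theorem decIn_turingJump_of_steps {col : ℕ → Bool} {p : ℕ → Condition col} {e : ℕ → Bool → ℕ}
    {i v : ℕ → Bool} {E : ℕ → Finset ℕ} {u : ℕ → ℕ} {x : ℕ → Bool → ℕ}
    (hstep : ∀ s, (p s).Step (p (s + 1)) (e s) (i s) (v s) (E s) (u s) (x s)) (hb : (p 0).b = 0)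
    {j : Bool} (hj : ∀ n, ∃ s, i s = j ∧ e s j = n) {G : Set ℕ} (hG : ∀ s, (p s).Admits j G)
    {O : ℕ → ℕ} (hGO : ComputableIn (orc O) (chi G)) (hO : ComputableIn (orc O) zeroJump) :
    DecIn O (· ∈ turingJump G) := by
  -- The initial verdict is about neither side.
  let W : ℕ → ℕ := fun s => s.casesOn (Nat.pair 2 0) fun s => verdict (i s) (e s (i s)) (v s)
  let f : ℕ → Part DecoderState := fun n =>
    n.rec (Part.some ((p 0).a, 0, W 0)) fun _ IH => IH.bind (decodeStep G)
  have hf : RecursiveIn (orc O) f := by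
    have h := RecursiveIn.comp (g := fun q : ℕ × ℕ × DecoderState => q.2.2)
      (recursiveIn_decodeStep hGO hO) (Primrec.snd.comp Primrec.snd).computableIn
    exact RecursiveIn.nat_rec (f := fun n : ℕ => n) (g := fun _ => Part.some ((p 0).a, 0, W 0))
      (h := fun _ q => decodeStep G q.2) .id (ComputableIn.const _) h
  -- The decoder reaches a state for each condition, and carries correct verdicts on the way.
  have hrun : ∀ s, ∃ n β, s ≤ n ∧ β ≤ (p s).b ∧ (∀ y ∈ G, β ≤ y → (p s).b ≤ y) ∧
      ((p s).a, β, W s) ∈ f n ∧ ∀ n' ≤ n, ∃ S ∈ f n', ∃ s, S.2.2 = W s := by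
    intro s
    induction s with
    | zero =>
      refine ⟨0, 0, le_rfl, Nat.zero_le _, fun y _ _ => hb.le.trans y.zero_le, Part.mem_some _,
        fun n' hn' => ?_⟩
      obtain rfl := Nat.le_zero.1 hn'
      exact ⟨_, Part.mem_some _, 0, rfl⟩
    | succ s ih =>
      obtain ⟨n, β, hsn, hβ, hgap, hmem, hprev⟩ := ih
      obtain ⟨β', hβ', hgap', h | ⟨S, hS, hSw, h⟩⟩ :=
        (hstep s).exists_decodeStep (hG (s + 1)) (w := W s) hβ hgap
      · have h₁ : ((p (s + 1)).a, β', W (s + 1)) ∈ f (n + 1) := Part.mem_bind hmem h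
        refine ⟨n + 1, β', by omega, hβ', hgap', h₁, fun n' hn' => ?_⟩
        rcases Nat.le_succ_iff.1 hn' with hn' | rfl
        · exact hprev n' hn'
        · exact ⟨_, h₁, s + 1, rfl⟩
      · have h₀ : S ∈ f (n + 1) := Part.mem_bind hmem hS
        have h₁ : ((p (s + 1)).a, β', W (s + 1)) ∈ f (n + 2) := Part.mem_bind h₀ h
        refine ⟨n + 2, β', by omega, hβ', hgap', h₁, fun n' hn' => ?_⟩
        rcases Nat.le_succ_iff.1 hn' with hn' | rfl
        · rcases Nat.le_succ_iff.1 hn' with hn' | rfl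
          · exact hprev n' hn'
          · exact ⟨_, h₀, s, hSw⟩
        · exact ⟨_, h₁, s + 1, rfl⟩
  have htot : ∀ n, ∃ S, S ∈ f n ∧ ∃ s, S.2.2 = W s := fun n => by
    obtain ⟨n', _, hn, -, -, -, h⟩ := hrun n
    exact h n hn
  choose S hS hSW using htot
  have hSc : ComputableIn (orc O) S := RecursiveIn.of_eq_tot hf hS
  have hw := (Primrec.snd.comp Primrec.snd).computableIn.comp hSc
  refine decIn_of_verdicts (t₀ := j.toNat) (w := fun n => (S n).2.2) hw (fun k n b hk => ?_)
    fun n => ?_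
  · obtain ⟨s, hs⟩ := hSW k
    rw [hs] at hk
    cases s with
    | zero =>
      have := (Nat.pair_eq_pair.1 hk).1
      cases j <;> simp at this
    | succ s =>
      obtain ⟨h₁, h₂⟩ := Nat.pair_eq_pair.1 hk
      obtain ⟨h₂, h₃⟩ := Nat.pair_eq_pair.1 h₂
      have hij : i s = j := by
        revert h₁
        cases i s <;> cases j <;> simp
      have := (hstep s).decides G (hij ▸ hG (s + 1))
      rw [h₂] at this
      rw [mem_turingJump, this, ← h₃]
      cases v s <;> simp
  · obtain ⟨s, hs, hn⟩ := hj n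
    obtain ⟨k, β, -, -, -, hk, -⟩ := hrun (s + 1)
    refine ⟨k, (v s).toNat, ?_⟩
    rw [Part.mem_unique (hS k) hk, ← hn, ← hs]
    rfl

/-! ### Generalized lowness -/

/-- The halting problem and `G` are reducible to the jump of `G`. -/
theorem computableIn_setJoin_jump (G : Set ℕ) :
    ComputableIn (orc (chi (turingJump G))) (chi (setJoin G (turingJump ∅))) := by
  have h₁ : DecIn (chi (turingJump G)) (· ∈ G) := (decIn_chi G).semiIn.decIn_jump
  have h₂ : DecIn (chi (turingJump G)) (· ∈ turingJump ∅) := by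
    have h : SemiIn (chi ∅) (· ∈ turingJump ∅) :=
      (semiIn_halts (chi ∅)).comp (ComputableIn.pair .id .id)
    have h₀ : ComputableIn (orc (chi G)) (chi ∅) :=
      computableIn_chi_iff.2 ⟨fun _ => false, .const false, by simp⟩
    exact (h.trans h₀).decIn_jump
  obtain ⟨d₁, hd₁, h₁⟩ := h₁.comp (Primrec.nat_div2 : Primrec Nat.div2).computableIn
  obtain ⟨d₂, hd₂, h₂⟩ := h₂.comp (Primrec.nat_div2 : Primrec Nat.div2).computableIn
  have h : Primrec fun q : Bool × Bool × Bool => cond q.1 q.2.2 q.2.1 :=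
    Primrec.cond Primrec.fst (Primrec.snd.comp Primrec.snd) (Primrec.fst.comp Primrec.snd)
  have h' := h.computableIn.comp ((Primrec.nat_bodd : Primrec Nat.bodd).computableIn.pair
    (hd₁.pair hd₂))
  refine computableIn_chi_iff.2 ⟨_, h', fun n => ?_⟩
  have hn := Nat.bodd_add_div2 n
  cases hodd : n.bodd
  · rw [hodd] at hn
    simp only [cond_false, ← h₁ n, setJoin, Set.mem_ofPred_eq]
    constructor
    · rintro (⟨m, hm, rfl⟩ | ⟨m, -, rfl⟩)
      · simpa using hm
      · simp at hodd
    · exact fun hG => Or.inl ⟨_, hG, by simpa using hn.symm⟩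
  · rw [hodd] at hn
    simp only [cond_true, ← h₂ n, setJoin, Set.mem_ofPred_eq]
    constructor
    · rintro (⟨m, -, rfl⟩ | ⟨m, hm, rfl⟩)
      · simp at hodd
      · have : (2 * m + 1).div2 = m := by simp [Nat.div2_val]
        rwa [this]
    · exact fun hG => Or.inr ⟨_, hG, by simp at hn; omega⟩

theorem computableIn_setJoin_left (X Y : Set ℕ) :
    ComputableIn (orc (chi (setJoin X Y))) (chi X) := by
  have h : Primrec fun n => 2 * n := Primrec.nat_mul.comp (.const 2) .id
  obtain ⟨d, hd, h⟩ := (decIn_chi (setJoin X Y)).comp h.computableIn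
  refine computableIn_chi_iff.2 ⟨d, hd, fun n => (Iff.trans ?_ (h n))⟩
  refine ⟨fun hn => Or.inl ⟨n, hn, rfl⟩, ?_⟩
  rintro (⟨m, hm, h⟩ | ⟨m, hm, h⟩)
  · rwa [show n = m by omega]
  · omega

theorem computableIn_setJoin_right (X Y : Set ℕ) :
    ComputableIn (orc (chi (setJoin X Y))) (chi Y) := by
  have h : Primrec fun n => 2 * n + 1 := Primrec.succ.comp (Primrec.nat_mul.comp (.const 2) .id)
  obtain ⟨d, hd, h⟩ := (decIn_chi (setJoin X Y)).comp h.computableIn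
  refine computableIn_chi_iff.2 ⟨d, hd, fun n => (Iff.trans ?_ (h n))⟩
  refine ⟨fun hn => Or.inr ⟨n, hn, rfl⟩, ?_⟩
  rintro (⟨m, hm, h⟩ | ⟨m, hm, h⟩)
  · omega
  · rwa [show n = m by omega]

theorem setTuringEquivalent_of_decIn {G : Set ℕ}
    (h : DecIn (chi (setJoin G (turingJump ∅))) (· ∈ turingJump G)) :
    SetTuringEquivalent (turingJump G) (setJoin G (turingJump ∅)) :=
  ⟨computableIn_chi_iff.2 h, computableIn_setJoin_jump G⟩

/-- If both colours occur on every infinite low set, then some infinite homogeneous set is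
generalized low. -/
theorem exists_generalizedLow {col : ℕ → Bool}
    (hcol : ∀ Y : Set ℕ, Y.Infinite → Low (chi Y) → ∀ j, ∃ x ∈ Y, col x = j) :
    ∃ (j : Bool) (G : Set ℕ), G.Infinite ∧ (∀ x ∈ G, col x = j) ∧
      DecIn (chi (setJoin G (turingJump ∅))) (· ∈ turingJump G) := by
  obtain ⟨p₀, hp₀⟩ := Condition.exists_initial (col := col)
  -- At stage `s` a pair of programs is treated, one for each side.
  let e : ℕ → Bool → ℕ := fun s j => cond j s.unpair.1 s.unpair.2
  have h := fun (p : Condition col) s => Condition.exists_step hcol p (e s)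
  choose next i v E u x hnext using h
  let p : ℕ → Condition col := fun s => s.rec p₀ fun s p => next p s
  have hstep : ∀ s, (p s).Step (p (s + 1)) (e s) (i (p s) s) (v (p s) s) (E (p s) s) (u (p s) s)
      (x (p s) s) := fun s => hnext (p s) s
  let G : Bool → Set ℕ := fun j => {y | ∃ s, y ∈ (p s).F j}
  have hmono : ∀ j s t, s ≤ t → (p s).F j ⊆ (p t).F j := fun j s t hst => by
    induction hst with
    | refl => exact subset_rfl
    | step _ ih => exact ih.trans fun y hy => ((hstep _).mem_F j y).2 (Or.inl hy)
  have hadm : ∀ j s t, (p s).Admits j ↑((p (s + t)).F j) := fun j s t => by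
    induction t generalizing s with
    | zero => exact ⟨subset_rfl, fun y hy => Or.inl hy⟩
    | succ t ih =>
      refine (hstep s).admits ?_
      rw [show s + (t + 1) = s + 1 + t by omega]
      exact ih (s + 1)
  have hG : ∀ j s, (p s).Admits j (G j) := fun j s => by
    refine ⟨fun y hy => ⟨s, hy⟩, fun y ⟨t, hy⟩ => (hadm j s t).2 y (hmono j t _ (by omega) hy)⟩
  -- If program `n` is never treated on side `true` and program `m` never on side `false`, then
  -- neither is treated at the stage devoted to the pair of them.
  obtain ⟨j, hj⟩ : ∃ j, ∀ n, ∃ s, i (p s) s = j ∧ e s j = n := by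
    by_contra! hcon
    obtain ⟨n, hn⟩ := hcon true
    obtain ⟨m, hm⟩ := hcon false
    cases hi : i (p (Nat.pair n m)) (Nat.pair n m)
    · exact hm _ hi (by simp [e])
    · exact hn _ hi (by simp [e])
  refine ⟨j, G j, ?_, fun y ⟨s, hy⟩ => (p s).col_eq j y hy,
    decIn_turingJump_of_steps hstep hp₀ hj (hG j) (computableIn_setJoin_left _ _)
      (computableIn_setJoin_right _ _)⟩
  refine Set.infinite_of_forall_exists_gt fun n => ?_
  have hb : ∀ s, s ≤ (p s).b := fun s => by
    induction s with
    | zero => exact Nat.zero_le _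
    | succ s ih =>
      have := (hstep s).mem_x true
      omega
  have hx := (hstep (n + 1)).mem_x j
  have := hb (n + 1)
  exact ⟨x (p (n + 1)) (n + 1) j, ⟨n + 2, ((hstep (n + 1)).mem_F j _).2 (Or.inr (Or.inr rfl))⟩,
    by omega⟩

theorem mainTheorem1 (c : ℕ → Fin 2) :
    ∃ G : Set ℕ, G.Infinite ∧ IsHomogeneousFor c G ∧
      SetTuringEquivalent (turingJump G) (setJoin G (turingJump ∅)) := by
  by_cases hcol : ∀ Y : Set ℕ, Y.Infinite → Low (chi Y) → ∀ j : Bool, ∃ x ∈ Y, decide (c x = 1) = j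
  · -- The side `true` is the colour `1`.
    obtain ⟨j, G, hG, hGj, hdec⟩ := exists_generalizedLow hcol
    refine ⟨G, hG, ⟨cond j 1 0, fun x hx => ?_⟩, setTuringEquivalent_of_decIn hdec⟩
    have := hGj x hx
    cases j <;> simp at this ⊢ <;> omega
  · -- An infinite low set missing one colour is itself a solution.
    push Not at hcol
    obtain ⟨G, hG, hlow, j, hj⟩ := hcol
    refine ⟨G, hG, ⟨cond j 0 1, fun x hx => ?_⟩, setTuringEquivalent_of_decIn ?_⟩
    · have := hj x hx
      cases j <;> simp at this ⊢ <;> omega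
    · have h : SemiIn (chi G) (· ∈ turingJump G) :=
        (semiIn_halts (chi G)).comp (ComputableIn.pair .id .id)
      exact (hlow _ h).trans (computableIn_setJoin_right _ _)
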